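/- A \emph{lane graph} on a finite set $\mathcal X$ of $n$ cells gives each cell $x$ at most one left neighbor $\mathrm{lnb}(x)$, at most one right neighbor $\mathrm{rnb}(x)$ (with $x_1=\mathrm{lnb}(x_2)\iff x_2=\mathrm{rnb}(x_1)$), a set $\mathrm{succ}(x)$ of successors and a set $\mathrm{pred}(x)$ of predecessors (with $x_1\in\mathrm{succ}(x_2)\iff x_2\in\mathrm{pred}(x_1)$), a length $\ell(x)>0$ and a cost $c(x)>0$. Its edge set $\mathcal E$ consists of all these neighbor, successor and predecessor relations. Let $\alpha>0$, $c_{\mathrm{lc}}\ge 0$, $c_{\mathrm{flc}}\ge 0$ and $f(\ell)=1-e^{-\alpha\ell}$. In a cell $x$ the available actions $\mathcal A(x)$ are: (i) for $x_s\in\mathrm{succ}(x)$, stay in lane, moving to $x_s$ at cost $c(x)$; (ii) for a neighbor $x_n$ of $x$, $x_s\in\mathrm{succ}(x)$ and $x_{ns}\in\mathrm{succ}(x_n)$, a lane change, moving to $x_{ns}$ at cost $c_{\mathrm{lc}}+c(x)$ with probability $f(\ell(x))$ and to $x_s$ at cost $c(x)$ with probability $1-f(\ell(x))$; (iii) for a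 neighbor $x_n$ of $x$ and $x_{ns}\in\mathrm{succ}(x_n)$, a forced lane change, moving to $x_{ns}$ at cost $c_{\mathrm{lc}}+c(x)+(1-f(\ell(x)))\,c_{\mathrm{flc}}$. For a goal cell $x_g$ let $g^*(x)\in[0,\infty]$ be the infimum, over all (history-dependent) policies, of the expected total cost of reaching $x_g$ from $x$; stopping in a cell other than $x_g$ costs $\infty$. For $g:\mathcal X\to[0,\infty]$ let $q_g(x,a)$ be the expected value of the cost of $a$ in $x$ plus the value of $g$ at the next cell, and let $p(x'\mid x,a)$ be the transition probabilities. Call $(g,\pi)$ a \emph{solution} if $g=g^*$; $g(x_g)=0$ and $g(x)=\min_{a\in\mathcal A(x)}q_g(x,a)$ for $x\ne x_g$ (with $\min\varnothing=\infty$); $\pi(x)$ is undefined for $x=x_g$ and for all $x$ with $g(x)=\infty$, and $\pi(x)\in\arg\min_{a\in\mathcal A(x)}q_g(x,a)$ for every other $x$; and following $\pi$ from any cell $x$ has expected total cost $g(x)$. The \emph{Router} algorithm starts with $g(x_g)=0$, $g(x)=\infty$ for $x\neq x_g$, $\pi$ undefined everywhere, and the queue $Q=\{x_g\}$. While $Q\ne\varnothing$,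 it removes from $Q$ a cell $\bar x$ with minimal $g(\bar x)$, and then, one after the other, in any order, for each pair $(x,a)$ with $a\in\mathcal A(x)$ and $p(\bar x\mid x,a)>0$: if $q_g(x,a)<g(x)$ for the current $g$, it sets $g(x)\gets q_g(x,a)$, $\pi(x)\gets a$ and $Q\gets Q\cup\{x\}$. \textbf{Theorem.} Consider lane graphs, parameters $\alpha,c_{\mathrm{lc}},c_{\mathrm{flc}}$ and goal cells such that $c(x)/\ell(x)\ge\alpha\,c_{\mathrm{flc}}$ for all cells $x$. (1) Whatever the order of processing and the choice among ties, the Router algorithm stops after at most $n$ iterations of its main loop, and the pair $(g,\pi)$ that it ends with is a solution. (2) A solution can be computed in time $O(n\log n)$ if $|\mathcal E|=O(n)$: there is one program for a random access machine with exact real arithmetic (unit cost for memory access, for $+1$, $-1$, halving and comparison of integers, and for $+$, $-$, $\cdot$, $\exp$ and comparison of reals) such that for every $K$ there is a constant $C$ for which the following holds. On every such instance with cells $0,\dots,n-1$ and $|\mathcal E|\le Kn$, given by the neighbors, the predecessor and successor lists (in any order), the lengths, the costs, the parameters and the goal cell, the program halts after at most $C\,n\log(n+1)$ steps with a solution $(g,\pi)$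 in its memory. -/

import Mathlib

open scoped ENNReal

noncomputable section

namespace LaneRouting

/-! ## Lane graphs -/

/-- A lane graph on the set of cells `X`: each cell has at most one left and at most one right
neighbor, a set of successors, a set of predecessors, a length and a traversal cost. -/
structure LaneGraph (X : Type*) where
  lnb : X → Option X
  rnb : X → Option X
  succ : X → Finset X
  pred : X → Finset X
  length : X → ℝ
  cost : X → ℝ
  lnb_iff_rnb : ∀ x y, lnb y = some x ↔ rnb x = some y
  succ_iff_pred : ∀ x y, x ∈ succ y ↔ y ∈ pred x
  length_pos : ∀ x, 0 < length x
  cost_pos : ∀ x, 0 < cost x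

/-- The number of directed edges, counting all four types of relationship
(left neighbor, right neighbor, successor, predecessor). -/
def LaneGraph.edgeCount {X : Type*} [Fintype X] (G : LaneGraph X) : ℕ :=
  ∑ x, ((G.lnb x).toFinset.card + (G.rnb x).toFinset.card + (G.succ x).card + (G.pred x).card)

/-- `m` is a (left or right) neighbor of `x`. -/
def LaneGraph.IsNeighbor {X : Type*} (G : LaneGraph X) (x m : X) : Prop :=
  G.lnb x = some m ∨ G.rnb x = some m

/-- The lane change success rate `α`, the lane change cost `c_lc` and the additional cost `c_flc`
of a forced lane change. -/
structure Params where
  rate : ℝ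
  cLc : ℝ
  cFlc : ℝ
  rate_pos : 0 < rate
  cLc_nonneg : 0 ≤ cLc
  cFlc_nonneg : 0 ≤ cFlc

/-- The probability `f(ℓ) = 1 - exp (-α ℓ)` that a lane change over length `ℓ` succeeds. -/
def Params.success (P : Params) (len : ℝ) : ℝ := 1 - Real.exp (-(P.rate * len))

/-! ## The Markov decision process -/

/-- Actions: stay in lane and go to the successor `s`; try to change to the neighbor `m`, ending
in `t` on success and in `s` on failure; force the change to the neighbor `m`, ending in `t`. -/
inductive Action (X : Type*) where
  | stay (s : X)
  | change (m s t : X)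
  | forced (m t : X)

/-- The set `𝒜(x)` of actions available in the cell `x`. -/
def LaneGraph.actions {X : Type*} (G : LaneGraph X) (x : X) : Set (Action X) :=
  {a | match a with
    | .stay s => s ∈ G.succ x
    | .change m s t => G.IsNeighbor x m ∧ s ∈ G.succ x ∧ t ∈ G.succ m
    | .forced m t => G.IsNeighbor x m ∧ t ∈ G.succ m}

/-- One possible outcome of an action: its probability, its cost and the next cell. -/
structure Outcome (X : Type*) where
  prob : ℝ≥0∞
  cost : ℝ≥0∞
  next : X

/-- The outcomes of taking the action `a` in the cell `x`. -/
def outcomes {X : Type*} (G : LaneGraph X) (P : Params) (x : X) : Action X → List (Outcome X)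
  | .stay s => [⟨1, ENNReal.ofReal (G.cost x), s⟩]
  | .change _ s t =>
      [⟨ENNReal.ofReal (P.success (G.length x)), ENNReal.ofReal (P.cLc + G.cost x), t⟩,
        ⟨ENNReal.ofReal (1 - P.success (G.length x)), ENNReal.ofReal (G.cost x), s⟩]
  | .forced _ t =>
      [⟨1, ENNReal.ofReal (P.cLc + G.cost x + (1 - P.success (G.length x)) * P.cFlc), t⟩]

/-- The transition probability `p(y | x, a)`. -/
def transProb {X : Type*} [DecidableEq X] (G : LaneGraph X) (P : Params) (x : X) (a : Action X)
    (y : X) : ℝ≥0∞ :=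
  ((outcomes G P x a).map fun o => if o.next = y then o.prob else 0).sum

/-- `q(x, a)`: the expected cost of taking the action `a` in `x` and paying `g` afterwards. -/
def qValue {X : Type*} (G : LaneGraph X) (P : Params) (g : X → ℝ≥0∞) (x : X) (a : Action X) :
    ℝ≥0∞ :=
  ((outcomes G P x a).map fun o => o.prob * (o.cost + g o.next)).sum

/-- A policy chooses, from the list of the cells visited before and the current cell, an action
that is available in the current cell, or none at all. -/
def IsPolicy {X : Type*} (G : LaneGraph X) (π : List X → X → Option (Action X)) : Prop :=
  ∀ h x a, π h x = some a → a ∈ G.actions x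

/-- The expected cost of the first `N` steps towards `goal` under the policy `π`, from the current
cell `x` with the history `h`. Giving up outside the goal costs `∞`. -/
def stepCost {X : Type*} [DecidableEq X] (G : LaneGraph X) (P : Params) (goal : X)
    (π : List X → X → Option (Action X)) : ℕ → List X → X → ℝ≥0∞
  | 0, _, _ => 0
  | N + 1, h, x =>
      if x = goal then 0
      else match π h x with
        | none => ⊤
        | some a => ((outcomes G P x a).map fun o =>
            o.prob * (o.cost + stepCost G P goal π N (h ++ [x]) o.next)).sum

/-- The expected total cost to reach `goal` from `x` under `π`. It is the limit of the increasing
sequence of expected `N`-step costs, and it is `∞` if the goal is missed with positive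
probability, because each step costs at least the minimal cost of a cell. -/
def expectedCost {X : Type*} [DecidableEq X] (G : LaneGraph X) (P : Params) (goal : X)
    (π : List X → X → Option (Action X)) (x : X) : ℝ≥0∞ :=
  ⨆ N, stepCost G P goal π N [] x

/-- The optimal expected cost-to-go: the infimum of the expected cost over all policies. -/
def costToGo {X : Type*} [DecidableEq X] (G : LaneGraph X) (P : Params) (goal : X) (x : X) :
    ℝ≥0∞ :=
  ⨅ π : {π : List X → X → Option (Action X) // IsPolicy G π}, expectedCost G P goal π.1 x

/-- `g` is the optimal cost-to-go, and `π` gives an optimal action for every cell, no action being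
given at the goal and at the cells from which the goal cannot be reached. -/
structure IsSolution {X : Type*} [DecidableEq X] (G : LaneGraph X) (P : Params) (goal : X)
    (g : X → ℝ≥0∞) (π : X → Option (Action X)) : Prop where
  cost_eq : ∀ x, g x = costToGo G P goal x
  cost_goal : g goal = 0
  bellman : ∀ x, x ≠ goal → g x = ⨅ a ∈ G.actions x, qValue G P g x a
  action_goal : π goal = none
  action_top : ∀ x, g x = ⊤ → π x = none
  action_opt : ∀ x, x ≠ goal → g x ≠ ⊤ → ∃ a ∈ G.actions x, π x = some a ∧
    ∀ b ∈ G.actions x, qValue G P g x a ≤ qValue G P g x b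
  policy_opt : ∀ x, expectedCost G P goal (fun _ => π) x = g x

/-! ## The Dijkstra-like algorithm -/

/-- The state of the algorithm: tentative values, tentative actions, and the queue. -/
structure RouterState (X : Type*) where
  g : X → ℝ≥0∞
  act : X → Option (Action X)
  queue : Finset X

/-- The initial state. -/
def routerInit {X : Type*} [DecidableEq X] (goal : X) : RouterState X where
  g := Function.update (fun _ => ⊤) goal 0
  act := fun _ => none
  queue := {goal}

/-- Processing the child `(x, a)`: if `q(x, a) < g(x)`, update the value and the action of `x`
and put `x` into the queue. -/
def relax {X : Type*} [DecidableEq X] (G : LaneGraph X) (P : Params) (s : RouterState X)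
    (c : X × Action X) : RouterState X :=
  if qValue G P s.g c.1 c.2 < s.g c.1 then
    { g := Function.update s.g c.1 (qValue G P s.g c.1 c.2)
      act := Function.update s.act c.1 (some c.2)
      queue := insert c.1 s.queue }
  else s

/-- One iteration of the main loop: a cell `z` of minimal value is removed from the queue, and all
pairs `(x, a)` with `p(z | x, a) > 0` are processed, in any order. -/
def RouterStep {X : Type*} [DecidableEq X] (G : LaneGraph X) (P : Params)
    (s s' : RouterState X) : Prop :=
  ∃ z ∈ s.queue, (∀ y ∈ s.queue, s.g z ≤ s.g y) ∧
    ∃ l : List (X × Action X), l.Nodup ∧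
      (∀ c, c ∈ l ↔ c.2 ∈ G.actions c.1 ∧ 0 < transProb G P c.1 c.2 z) ∧
      s' = l.foldl (relax G P) { s with queue := s.queue.erase z }

/-- `RouterRun G P goal k s`: the state `s` is reached after `k` iterations of the main loop. -/
inductive RouterRun {X : Type*} [DecidableEq X] (G : LaneGraph X) (P : Params) (goal : X) :
    ℕ → RouterState X → Prop
  | init : RouterRun G P goal 0 (routerInit goal)
  | step {k : ℕ} {s s' : RouterState X} :
      RouterRun G P goal k s → RouterStep G P s s' → RouterRun G P goal (k + 1) s'

/-! ## The machine model

A random access machine with integer and real registers and finitely many integer and real arrays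
(a program mentions only finitely many array names). A program is one fixed finite piece of code
for all inputs. Integer arithmetic is restricted to `+1`, `-1` and halving, so that integers stay
polynomial in the input size during a polynomial number of steps (unit cost is fair for them).
Real arithmetic is exact, with `+`, `-`, `*`, `exp` and comparison at unit cost; there is no
conversion from reals to integers. -/

/-- A memory state. -/
structure Memory where
  natReg : ℕ → ℕ
  realReg : ℕ → ℝ
  natArr : ℕ → ℕ → ℕ
  realArr : ℕ → ℕ → ℝ

/-- Integer expressions; `load a e` reads entry `e` of the integer array `a`. -/
inductive NatExpr where
  | const (k : ℕ)
  | reg (i : ℕ)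
  | load (a : ℕ) (e : NatExpr)
  | inc (e : NatExpr)
  | dec (e : NatExpr)
  | half (e : NatExpr)

def NatExpr.eval (m : Memory) : NatExpr → ℕ
  | const k => k
  | reg i => m.natReg i
  | load a e => m.natArr a (e.eval m)
  | inc e => e.eval m + 1
  | dec e => e.eval m - 1
  | half e => e.eval m / 2

/-- The number of steps that it takes to evaluate the expression. -/
def NatExpr.time : NatExpr → ℕ
  | const _ => 1
  | reg _ => 1
  | load _ e => e.time + 1
  | inc e => e.time + 1
  | dec e => e.time + 1
  | half e => e.time + 1

/-- Real expressions; `load a e` reads entry `e` of the real array `a`. -/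
inductive RealExpr where
  | const (k : ℕ)
  | reg (i : ℕ)
  | load (a : ℕ) (e : NatExpr)
  | add (e₁ e₂ : RealExpr)
  | sub (e₁ e₂ : RealExpr)
  | mul (e₁ e₂ : RealExpr)
  | exp (e : RealExpr)

def RealExpr.eval (m : Memory) : RealExpr → ℝ
  | const k => k
  | reg i => m.realReg i
  | load a e => m.realArr a (e.eval m)
  | add e₁ e₂ => e₁.eval m + e₂.eval m
  | sub e₁ e₂ => e₁.eval m - e₂.eval m
  | mul e₁ e₂ => e₁.eval m * e₂.eval m
  | exp e => Real.exp (e.eval m)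

/-- The number of steps that it takes to evaluate the expression. -/
def RealExpr.time : RealExpr → ℕ
  | const _ => 1
  | reg _ => 1
  | load _ e => e.time + 1
  | add e₁ e₂ => e₁.time + e₂.time + 1
  | sub e₁ e₂ => e₁.time + e₂.time + 1
  | mul e₁ e₂ => e₁.time + e₂.time + 1
  | exp e => e.time + 1

/-- Tests. -/
inductive Test where
  | natLt (e₁ e₂ : NatExpr)
  | natEq (e₁ e₂ : NatExpr)
  | realLt (e₁ e₂ : RealExpr)
  | neg (b : Test)
  | and (b₁ b₂ : Test)

def Test.Holds (m : Memory) : Test → Prop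
  | natLt e₁ e₂ => e₁.eval m < e₂.eval m
  | natEq e₁ e₂ => e₁.eval m = e₂.eval m
  | realLt e₁ e₂ => e₁.eval m < e₂.eval m
  | neg b => ¬ b.Holds m
  | and b₁ b₂ => b₁.Holds m ∧ b₂.Holds m

/-- The number of steps that it takes to evaluate the test. -/
def Test.time : Test → ℕ
  | natLt e₁ e₂ => e₁.time + e₂.time + 1
  | natEq e₁ e₂ => e₁.time + e₂.time + 1
  | realLt e₁ e₂ => e₁.time + e₂.time + 1
  | neg b => b.time + 1
  | and b₁ b₂ => b₁.time + b₂.time + 1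

/-- Programs; `storeNat a i e` writes `e` to entry `i` of the integer array `a`. -/
inductive Program where
  | skip
  | setNat (r : ℕ) (e : NatExpr)
  | setReal (r : ℕ) (e : RealExpr)
  | storeNat (a : ℕ) (i e : NatExpr)
  | storeReal (a : ℕ) (i : NatExpr) (e : RealExpr)
  | seq (p₁ p₂ : Program)
  | ite (b : Test) (p₁ p₂ : Program)
  | while (b : Test) (p : Program)

/-- `Exec p m t m'`: started in `m`, the program `p` halts after `t` steps in `m'`. -/
inductive Exec : Program → Memory → ℕ → Memory → Prop
  | skip (m : Memory) : Exec .skip m 1 m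
  | setNat (m : Memory) (r : ℕ) (e : NatExpr) :
      Exec (.setNat r e) m (e.time + 1)
        { m with natReg := Function.update m.natReg r (e.eval m) }
  | setReal (m : Memory) (r : ℕ) (e : RealExpr) :
      Exec (.setReal r e) m (e.time + 1)
        { m with realReg := Function.update m.realReg r (e.eval m) }
  | storeNat (m : Memory) (a : ℕ) (i e : NatExpr) :
      Exec (.storeNat a i e) m (i.time + e.time + 1)
        { m with natArr :=
            Function.update m.natArr a (Function.update (m.natArr a) (i.eval m) (e.eval m)) }
  | storeReal (m : Memory) (a : ℕ) (i : NatExpr) (e : RealExpr) :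
      Exec (.storeReal a i e) m (i.time + e.time + 1)
        { m with realArr :=
            Function.update m.realArr a (Function.update (m.realArr a) (i.eval m) (e.eval m)) }
  | seq {p₁ p₂ : Program} {m m' m'' : Memory} {t₁ t₂ : ℕ} :
      Exec p₁ m t₁ m' → Exec p₂ m' t₂ m'' → Exec (.seq p₁ p₂) m (t₁ + t₂) m''
  | ite_pos {b : Test} {p₁ p₂ : Program} {m m' : Memory} {t : ℕ} :
      b.Holds m → Exec p₁ m t m' → Exec (.ite b p₁ p₂) m (b.time + t) m'
  | ite_neg {b : Test} {p₁ p₂ : Program} {m m' : Memory} {t : ℕ} :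
      ¬ b.Holds m → Exec p₂ m t m' → Exec (.ite b p₁ p₂) m (b.time + t) m'
  | while_done {b : Test} {p : Program} {m : Memory} :
      ¬ b.Holds m → Exec (.while b p) m b.time m
  | while_step {b : Test} {p : Program} {m m' m'' : Memory} {t₁ t₂ : ℕ} :
      b.Holds m → Exec p m t₁ m' → Exec (.while b p) m' t₂ m'' →
        Exec (.while b p) m (b.time + t₁ + t₂) m''

/-! ## Input and output -/

/-- A possibly missing cell is stored as `0` if missing and as its number plus one otherwise. -/
def cellCode {n : ℕ} : Option (Fin n) → ℕ
  | none => 0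
  | some x => x + 1

/-- Adjacency lists: for each cell `x`, the entries `off x, …, off (x + 1) - 1` of `arr` list the
elements of `S x`, each once and in any order. -/
def StoresLists {n : ℕ} (off arr : ℕ → ℕ) (S : Fin n → Finset (Fin n)) : Prop :=
  off 0 = 0 ∧ ∀ x : Fin n, off x ≤ off (x + 1) ∧
    Set.BijOn arr (Set.Ico (off x) (off (x + 1))) ((fun y : Fin n => (y : ℕ)) '' (S x : Set (Fin n)))

/-- The memory `m` contains the input: number of cells, goal, neighbors, predecessor and successor
lists, the real parameters, lengths and costs. Nothing is assumed about the rest of `m`. -/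
structure StoresInput {n : ℕ} (m : Memory) (G : LaneGraph (Fin n)) (P : Params) (goal : Fin n) :
    Prop where
  size : m.natReg 0 = n
  goal : m.natReg 1 = goal
  rate : m.realReg 0 = P.rate
  cLc : m.realReg 1 = P.cLc
  cFlc : m.realReg 2 = P.cFlc
  lnb : ∀ x : Fin n, m.natArr 0 x = cellCode (G.lnb x)
  rnb : ∀ x : Fin n, m.natArr 1 x = cellCode (G.rnb x)
  pred : StoresLists (m.natArr 2) (m.natArr 3) G.pred
  succ : StoresLists (m.natArr 4) (m.natArr 5) G.succ
  length : ∀ x : Fin n, m.realArr 0 x = G.length x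
  cost : ∀ x : Fin n, m.realArr 1 x = G.cost x

/-- The memory `m` contains the value `v` for the cell `x`: a flag that tells whether the value is
finite, and the value itself if it is. -/
def StoresValue (m : Memory) (x : ℕ) (v : ℝ≥0∞) : Prop :=
  (m.natArr 6 x = 0 ∧ v = ⊤) ∨ (m.natArr 6 x = 1 ∧ v ≠ ⊤ ∧ m.realArr 2 x = v.toReal)

/-- The memory `m` contains the action `a` for the cell `x`: its type and its cells. -/
def StoresAction {n : ℕ} (m : Memory) (x : ℕ) : Option (Action (Fin n)) → Prop
  | none => m.natArr 7 x = 0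
  | some (.stay s) => m.natArr 7 x = 1 ∧ m.natArr 9 x = s
  | some (.change k s t) =>
      m.natArr 7 x = 2 ∧ m.natArr 8 x = k ∧ m.natArr 9 x = s ∧ m.natArr 10 x = t
  | some (.forced k t) => m.natArr 7 x = 3 ∧ m.natArr 8 x = k ∧ m.natArr 10 x = t

/-- The memory `m` contains the values `g` and the actions `π`. -/
def StoresOutput {n : ℕ} (m : Memory) (g : Fin n → ℝ≥0∞) (π : Fin n → Option (Action (Fin n))) :
    Prop :=
  ∀ x : Fin n, StoresValue m x (g x) ∧ StoresAction m x (π x)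

end LaneRouting

end

noncomputable section

namespace LaneRouting

/-! ## Values of actions -/

/-! Dijkstra's algorithm works for a Markov decision process when an optimal action leads only to
cells of strictly smaller value. Staying and forcing have a single target and positive cost, so only
the probabilistic lane change is in doubt. If it is no worse than staying in lane, then its success
target cannot be worse than its failure target, and already the traversal cost puts the success
target below the action. If it is no worse than the forced change to the same cell, then the failure
target exceeds the success target by at most `c_lc + c_flc`; the action then costs at least the
failure value plus `c - f(ℓ) c_flc`, and this surplus is positive because `f(ℓ) < α ℓ` and `α ℓ
c_flc ≤ c`. These are `lt_qValue_change_of_le_stay` and `lt_qValue_change_of_le_forced`, combined in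
`lt_of_optimal`.

The strict decrease is used twice. For the optimal values, let `V` be the limit of value iteration
from zero, a lower bound for every policy. A function vanishing at the goal that no action improves
lies below `V`: at a violation with minimal `V`, the targets of a `V`-optimal action have smaller
`V`, so they are no violations, and one Bellman step gives a contradiction (`le_expectedCost`). If
moreover stored actions attain the function, their policy costs no more than it, so the function is
optimal (`isSolution_of_le`). For the algorithm, `RouterInv.lt_qValue` shows that every improvement
found while processing `z` exceeds `g z`. Hence removed cells never change, each iteration removes a
new cell, and at the end no action improves the values.

Processing all actions would be too slow, since the lane changes between two neighbors are pairs of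
successors. But cells leave the queue in the order of their values, so the first successor of `m` to
leave is a best one, and actions into other successors are dominated (`qValue_le_of_dominated`).
Only a bounded number of relaxations is then needed per cell. The queue is a tournament tree in
which a change at one leaf is repaired along the path to the root, in logarithmic time. A scan of
the predecessor lists with this queue gives the time bound, and `main_halts` couples the program to
the abstract invariant. -/

/-- The cells that an action can lead to. -/
def Action.targets {X : Type*} : Action X → List X
  | .stay s => [s]
  | .change _ s t => [t, s]
  | .forced _ t => [t]

lemma Params.success_pos (P : Params) {len : ℝ} (h : 0 < len) : 0 < P.success len := by
  have : Real.exp (-(P.rate * len)) < 1 := by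
    rw [Real.exp_lt_one_iff]
    have := mul_pos P.rate_pos h
    linarith
  unfold Params.success
  linarith

lemma Params.success_lt_one (P : Params) (len : ℝ) : P.success len < 1 := by
  have := Real.exp_pos (-(P.rate * len))
  unfold Params.success
  linarith

/-- This is where the lower bound on the cost per length enters: `1 - exp (-u) < u` for `u > 0`
makes the success probability smaller than `α ℓ`, and the expected saving on the forcing cost stays
below the traversal cost. -/
lemma Params.success_mul_cFlc_lt (P : Params) {len c : ℝ} (hl : 0 < len) (hc : 0 < c)
    (h : P.rate * P.cFlc ≤ c / len) : P.success len * P.cFlc < c := by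
  rw [le_div_iff₀ hl] at h
  have h1 := Real.add_one_lt_exp (x := -(P.rate * len)) (by have := mul_pos P.rate_pos hl; linarith)
  have h2 : P.success len < P.rate * len := by
    unfold Params.success
    linarith
  -- The strict bound on the probability is lost on multiplication by a zero `cFlc`; then positivity
  -- of the cost suffices.
  rcases P.cFlc_nonneg.eq_or_lt with h3 | h3
  · rw [← h3]
    simpa using hc
  · nlinarith

section Values

variable {X : Type*} (G : LaneGraph X) (P : Params) (g : X → ℝ≥0∞) (x : X)

lemma qValue_stay (s : X) :
    qValue G P g x (.stay s) = ENNReal.ofReal (G.cost x) + g s := by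
  simp [qValue, outcomes]

lemma qValue_change (m s t : X) :
    qValue G P g x (.change m s t) =
      ENNReal.ofReal (P.success (G.length x)) * (ENNReal.ofReal (P.cLc + G.cost x) + g t) +
        ENNReal.ofReal (1 - P.success (G.length x)) * (ENNReal.ofReal (G.cost x) + g s) := by
  simp [qValue, outcomes]

lemma qValue_forced (m t : X) :
    qValue G P g x (.forced m t) =
      ENNReal.ofReal (P.cLc + G.cost x + (1 - P.success (G.length x)) * P.cFlc) + g t := by
  simp [qValue, outcomes]

lemma qValue_stay_eq_ofReal {s : X} (hs : g s ≠ ⊤) :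
    qValue G P g x (.stay s) = ENNReal.ofReal (G.cost x + (g s).toReal) := by
  rw [qValue_stay, ENNReal.ofReal_add (G.cost_pos x).le ENNReal.toReal_nonneg,
    ENNReal.ofReal_toReal hs]

lemma qValue_change_eq_ofReal (m : X) {s t : X} (hs : g s ≠ ⊤) (ht : g t ≠ ⊤) :
    qValue G P g x (.change m s t) =
      ENNReal.ofReal (P.success (G.length x) * (P.cLc + G.cost x + (g t).toReal) +
        (1 - P.success (G.length x)) * (G.cost x + (g s).toReal)) := by
  have h0 := P.success_pos (G.length_pos x)
  have h1 := P.success_lt_one (G.length x)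
  have hc := G.cost_pos x
  have hl := P.cLc_nonneg
  have hs' := ENNReal.toReal_nonneg (a := g s)
  have ht' := ENNReal.toReal_nonneg (a := g t)
  have h1' : 0 ≤ 1 - P.success (G.length x) := by linarith
  rw [ENNReal.ofReal_add (by positivity) (by positivity),
    ENNReal.ofReal_mul h0.le, ENNReal.ofReal_mul h1',
    ENNReal.ofReal_add (add_nonneg hl hc.le) ht', ENNReal.ofReal_add hc.le hs',
    ENNReal.ofReal_toReal hs, ENNReal.ofReal_toReal ht, qValue_change]

lemma qValue_forced_eq_ofReal (m : X) {t : X} (ht : g t ≠ ⊤) :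
    qValue G P g x (.forced m t) =
      ENNReal.ofReal (P.cLc + G.cost x + (1 - P.success (G.length x)) * P.cFlc +
        (g t).toReal) := by
  have h1 := P.success_lt_one (G.length x)
  have hc := G.cost_pos x
  have hl := P.cLc_nonneg
  have hf := P.cFlc_nonneg
  have h1' : 0 ≤ 1 - P.success (G.length x) := by linarith
  rw [qValue_forced, ENNReal.ofReal_add (by positivity) ENNReal.toReal_nonneg,
    ENNReal.ofReal_toReal ht]

variable {g x}

lemma ofReal_success_add :
    ENNReal.ofReal (P.success (G.length x)) + ENNReal.ofReal (1 - P.success (G.length x)) = 1 := by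
  have h0 := P.success_pos (G.length_pos x)
  have h1 := P.success_lt_one (G.length x)
  rw [← ENNReal.ofReal_add h0.le (by linarith)]
  simp

lemma qValue_mono {g g' : X → ℝ≥0∞} (a : Action X) (h : ∀ y ∈ a.targets, g y ≤ g' y) :
    qValue G P g x a ≤ qValue G P g' x a := by
  cases a <;> simp only [Action.targets, List.mem_cons, List.not_mem_nil, or_false, forall_eq,
    forall_eq_or_imp] at h
  · rw [qValue_stay, qValue_stay]
    gcongr
  · rw [qValue_change, qValue_change]
    obtain ⟨h1, h2⟩ := h
    gcongr
  · rw [qValue_forced, qValue_forced]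
    gcongr

lemma qValue_congr {g g' : X → ℝ≥0∞} (a : Action X) (h : ∀ y ∈ a.targets, g y = g' y) :
    qValue G P g x a = qValue G P g' x a :=
  le_antisymm (qValue_mono G P a fun y hy => (h y hy).le)
    (qValue_mono G P a fun y hy => (h y hy).ge)

/-- Both probabilities of a lane change are positive, so the convention `0 * ⊤ = 0` never hides an
unreachable target. -/
lemma qValue_eq_top {a : Action X} {y : X} (hy : y ∈ a.targets) (h : g y = ⊤) :
    qValue G P g x a = ⊤ := by
  have h0 := P.success_pos (G.length_pos x)
  have h1 := P.success_lt_one (G.length x)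
  have h2 : (ENNReal.ofReal (P.success (G.length x))) ≠ 0 := by simpa using h0
  have h3 : (ENNReal.ofReal (1 - P.success (G.length x))) ≠ 0 := by simpa using h1
  cases a <;> simp only [Action.targets, List.mem_cons, List.not_mem_nil, or_false] at hy
  · subst hy
    simp [qValue_stay, h]
  · rw [qValue_change]
    rcases hy with rfl | rfl
    · rw [h, add_top, ENNReal.mul_top h2, top_add]
    · rw [h, add_top, ENNReal.mul_top h3, add_top]
  · subst hy
    simp [qValue_forced, h]

/-- An action costs at least the traversal cost. -/
lemma add_le_qValue {a : Action X} {v : ℝ≥0∞} (h : ∀ y ∈ a.targets, v ≤ g y) :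
    ENNReal.ofReal (G.cost x) + v ≤ qValue G P g x a := by
  cases a <;> simp only [Action.targets, List.mem_cons, List.not_mem_nil, or_false, forall_eq,
    forall_eq_or_imp] at h
  · rw [qValue_stay]
    gcongr
  · rw [qValue_change]
    calc ENNReal.ofReal (G.cost x) + v
        = ENNReal.ofReal (P.success (G.length x)) * (ENNReal.ofReal (G.cost x) + v) +
          ENNReal.ofReal (1 - P.success (G.length x)) * (ENNReal.ofReal (G.cost x) + v) := by
          rw [← add_mul, ofReal_success_add, one_mul]
      _ ≤ _ := by
          have := P.cLc_nonneg
          obtain ⟨h1, h2⟩ := h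
          gcongr
          linarith
  · rw [qValue_forced]
    have h1 := P.success_lt_one (G.length x)
    have hf := P.cFlc_nonneg
    have hl := P.cLc_nonneg
    have := mul_nonneg (sub_nonneg.2 h1.le) hf
    gcongr
    linarith

lemma lt_qValue {a : Action X} {v : ℝ≥0∞} (hv : v ≠ ⊤) (h : ∀ y ∈ a.targets, v ≤ g y) :
    v < qValue G P g x a := by
  refine lt_of_lt_of_le ?_ (add_le_qValue G P h)
  rw [add_comm]
  exact ENNReal.lt_add_right hv (by simpa using G.cost_pos x)

/-! ### Comparing the lane change with staying and with forcing -/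

lemma qValue_stay_le_qValue_change (m : X) {s t : X} (h : g s ≤ g t) :
    qValue G P g x (.stay s) ≤ qValue G P g x (.change m s t) := by
  rw [qValue_stay]
  exact add_le_qValue G P (by simp [Action.targets, h])

/-- Trying the change pays off only if success leads to a cell that is at least as good as the one
reached on failure. Then `g t` is the smaller target value, and the traversal cost comes on top. -/
lemma lt_qValue_change_of_le_stay {m s t : X} (hs : g s ≠ ⊤) (ht : g t ≠ ⊤)
    (h : qValue G P g x (.change m s t) ≤ qValue G P g x (.stay s)) :
    g t < qValue G P g x (.change m s t) := by
  have h0 := P.success_pos (G.length_pos x)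
  have hl := P.cLc_nonneg
  refine lt_qValue G P ht ?_
  suffices g t ≤ g s by simp [Action.targets, this]
  rw [qValue_change_eq_ofReal G P g x m hs ht, qValue_stay_eq_ofReal G P g x hs,
    ENNReal.ofReal_le_ofReal_iff
      (add_nonneg (G.cost_pos x).le ENNReal.toReal_nonneg)] at h
  rw [← ENNReal.toReal_le_toReal ht hs]
  by_contra! h2
  nlinarith

/-- The success branches of the two actions are equal in cost up to the penalty, so the comparison
bounds the failure value by `g t + c_lc + c_flc`. Substituting this for `g t` in the lane change
leaves at least `g s + c - f c_flc`. -/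
lemma lt_qValue_change_of_le_forced {m s t : X} (hs : g s ≠ ⊤) (ht : g t ≠ ⊤)
    (hx : P.rate * P.cFlc ≤ G.cost x / G.length x)
    (h : qValue G P g x (.change m s t) ≤ qValue G P g x (.forced m t)) :
    g s < qValue G P g x (.change m s t) := by
  have h0 := P.success_pos (G.length_pos x)
  have h1 := P.success_lt_one (G.length x)
  have hl := P.cLc_nonneg
  have hf := P.cFlc_nonneg
  have hc := G.cost_pos x
  have hlt := P.success_mul_cFlc_lt (G.length_pos x) hc hx
  have hs' := ENNReal.toReal_nonneg (a := g s)
  have ht' := ENNReal.toReal_nonneg (a := g t)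
  have h1' : 0 < 1 - P.success (G.length x) := by linarith
  rw [qValue_change_eq_ofReal G P g x m hs ht, qValue_forced_eq_ofReal G P g x m ht,
    ENNReal.ofReal_le_ofReal_iff (by positivity)] at h
  rw [qValue_change_eq_ofReal G P g x m hs ht, ENNReal.lt_ofReal_iff_toReal_lt hs]
  generalize P.success (G.length x) = f at *
  generalize (g s).toReal = a at *
  generalize (g t).toReal = b at *
  -- The terms with factor `f` cancel in the comparison, and what remains has the common positive
  -- factor `1 - f`.
  have h4 : a ≤ b + P.cLc + P.cFlc := by
    refine le_of_mul_le_mul_left (a := 1 - f) ?_ h1'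
    linarith
  nlinarith

/-- The targets of an optimal action have a smaller value. -/
lemma lt_of_optimal {a : Action X} (hx : P.rate * P.cFlc ≤ G.cost x / G.length x)
    (ha : a ∈ G.actions x) (hg : g x ≠ ⊤) (he : qValue G P g x a ≤ g x)
    (hle : ∀ b ∈ G.actions x, g x ≤ qValue G P g x b) {y : X} (hy : y ∈ a.targets) :
    g y < g x := by
  have hfin : ∀ y ∈ a.targets, g y ≠ ⊤ := fun y hy h =>
    hg (top_le_iff.1 ((qValue_eq_top G P hy h).symm.le.trans he))
  refine lt_of_lt_of_le ?_ he
  cases a with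
  | stay s =>
    simp only [Action.targets, List.mem_cons, List.not_mem_nil, or_false] at hy
    subst hy
    exact lt_qValue G P (hfin _ (by simp [Action.targets])) (by simp [Action.targets])
  | forced m t =>
    simp only [Action.targets, List.mem_cons, List.not_mem_nil, or_false] at hy
    subst hy
    exact lt_qValue G P (hfin _ (by simp [Action.targets])) (by simp [Action.targets])
  | change m s t =>
    have hs := hfin s (by simp [Action.targets])
    have ht := hfin t (by simp [Action.targets])
    -- Availability of a lane change makes both `.stay s` and `.forced m t` available, so optimality
    -- compares it with each of them.
    obtain ⟨h1, h2, h3⟩ := ha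
    simp only [Action.targets, List.mem_cons, List.not_mem_nil, or_false] at hy
    rcases hy with rfl | rfl
    · exact lt_qValue_change_of_le_stay G P hs ht (he.trans (hle (.stay s) h2))
    · exact lt_qValue_change_of_le_forced G P hs ht hx (he.trans (hle (.forced m t) ⟨h1, h3⟩))

/-- The success probability lies strictly between 0 and 1, so the support of the transition is the
list of targets, also when the two targets coincide. -/
lemma transProb_pos_iff [DecidableEq X] (a : Action X) (y : X) :
    0 < transProb G P x a y ↔ y ∈ a.targets := by
  have h0 := P.success_pos (G.length_pos x)
  have h1 := P.success_lt_one (G.length x)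
  have h2 : (ENNReal.ofReal (P.success (G.length x))) ≠ 0 := by simpa using h0
  have h3 : (ENNReal.ofReal (1 - P.success (G.length x))) ≠ 0 := by simpa using h1
  rw [pos_iff_ne_zero]
  cases a with
  | stay s => simp [transProb, outcomes, Action.targets, eq_comm]
  | forced m t => simp [transProb, outcomes, Action.targets, eq_comm]
  | change m s t =>
    simp only [transProb, outcomes, Action.targets, List.map_cons, List.map_nil, List.sum_cons,
      List.sum_nil, add_zero, List.mem_cons, List.not_mem_nil, or_false, ne_eq, add_eq_zero,
      ite_eq_right_iff, h2, h3, imp_false, eq_comm (a := y)]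
    tauto

/-- Monotone convergence for a sum with at most two terms; monotonicity is needed to merge the two
suprema in a lane change. -/
lemma iSup_qValue {V : ℕ → X → ℝ≥0∞} (hV : ∀ x, Monotone fun N => V N x)
    (a : Action X) : ⨆ N, qValue G P (V N) x a = qValue G P (fun y => ⨆ N, V N y) x a := by
  cases a with
  | stay s => simp only [qValue_stay, ENNReal.add_iSup]
  | forced m t => simp only [qValue_forced, ENNReal.add_iSup]
  | change m s t =>
    simp only [qValue_change]
    rw [ENNReal.add_iSup, ENNReal.add_iSup, ENNReal.mul_iSup, ENNReal.mul_iSup,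
      ENNReal.iSup_add_iSup_of_monotone]
    · intro N M h
      have := hV t h
      dsimp only at *
      gcongr
    · intro N M h
      have := hV s h
      dsimp only at *
      gcongr

end Values

/-! ## Bellman's equation -/

/-- Finiteness makes Bellman minima attained and lets the minimum over actions commute with
increasing limits. -/
instance {X : Type*} [Finite X] : Finite (Action X) := by
  refine Finite.of_injective
    (fun a : Action X => match a with
      | .stay s => (Sum.inl s : X ⊕ (X × X × X) ⊕ X × X)
      | .change m s t => Sum.inr (Sum.inl (m, s, t))
      | .forced m t => Sum.inr (Sum.inr (m, t))) ?_
  intro a b h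
  cases a <;> cases b <;> simp_all

section Bellman

variable {X : Type*} [DecidableEq X] (G : LaneGraph X) (P : Params) (goal : X)

/-- The optimal expected cost of the first `N` steps. -/
def stepValue : ℕ → X → ℝ≥0∞
  | 0, _ => 0
  | N + 1, x => if x = goal then 0 else ⨅ a : G.actions x, qValue G P (stepValue N) x a

lemma stepValue_le_succ (N : ℕ) (x : X) :
    stepValue G P goal N x ≤ stepValue G P goal (N + 1) x := by
  induction N generalizing x with
  | zero => simp [stepValue]
  | succ N ih =>
    rw [stepValue, stepValue]
    split_ifs
    · exact le_rfl
    · exact iInf_mono fun a => qValue_mono G P _ fun y _ => ih y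

lemma stepValue_mono (x : X) : Monotone fun N => stepValue G P goal N x :=
  monotone_nat_of_le_succ fun N => stepValue_le_succ G P goal N x

lemma stepValue_le_stepCost {π : List X → X → Option (Action X)} (hπ : IsPolicy G π) (N : ℕ)
    (h : List X) (x : X) : stepValue G P goal N x ≤ stepCost G P goal π N h x := by
  induction N generalizing h x with
  | zero => simp [stepValue]
  | succ N ih =>
    rw [stepValue, stepCost]
    split_ifs
    · exact le_rfl
    · cases ha : π h x with
      | none => exact le_top
      | some a =>
        refine (iInf_le _ ⟨a, hπ _ _ _ ha⟩).trans ?_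
        exact List.sum_le_sum fun o _ => by gcongr; exact ih _ _

/-- Value iteration increases, so its limit commutes with the minimum over finitely many actions and
satisfies Bellman's equation. -/
lemma iSup_stepValue_eq [Finite X] {x : X} (hx : x ≠ goal) :
    ⨆ N, stepValue G P goal N x =
      ⨅ a : G.actions x, qValue G P (fun y => ⨆ N, stepValue G P goal N y) x a := by
  have hmono := stepValue_mono G P goal
  rw [← (hmono x).iSup_nat_add 1]
  simp only [stepValue, if_neg hx]
  rw [iSup_iInf_of_monotone
    (f := fun (a : G.actions x) N => qValue G P (stepValue G P goal N) x a)]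
  · simp only [iSup_qValue G P hmono]
  · intro a N M h
    exact qValue_mono G P _ fun y _ => hmono y h

variable {G P goal}

/-- A function that no action improves is bounded by the expected cost of every policy. -/
lemma le_expectedCost [Finite X] (hG : ∀ x, P.rate * P.cFlc ≤ G.cost x / G.length x)
    {g : X → ℝ≥0∞} (h0 : g goal = 0) (hg : ∀ x, ∀ a ∈ G.actions x, g x ≤ qValue G P g x a)
    {π : List X → X → Option (Action X)} (hπ : IsPolicy G π) (x : X) :
    g x ≤ expectedCost G P goal π x := by
  refine le_trans ?_ (iSup_mono fun N => stepValue_le_stepCost G P goal hπ N [] x)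
  set V : X → ℝ≥0∞ := fun y => ⨆ N, stepValue G P goal N y with hV
  change g x ≤ V x
  by_contra hx
  -- A violation with the smallest limit value: the targets of its optimal action have still smaller
  -- `V`, hence are no violations.
  obtain ⟨y, hy, hmin⟩ := Set.exists_min_image {y | ¬ g y ≤ V y} V (Set.toFinite _) ⟨x, hx⟩
  have hyg : y ≠ goal := by
    rintro rfl
    exact hy (by simp [h0])
  have hVy : V y = ⨅ a : G.actions y, qValue G P V y a := iSup_stepValue_eq G P goal hyg
  have hne : V y ≠ ⊤ := fun h => hy (by simp [h])
  have hnon : Nonempty (G.actions y) := by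
    by_contra hemp
    rw [not_nonempty_iff] at hemp
    exact hne (by rw [hVy, iInf_of_empty])
  obtain ⟨a, ha⟩ := exists_eq_ciInf_of_finite (f := fun a : G.actions y => qValue G P V y a)
  have hle : ∀ b ∈ G.actions y, V y ≤ qValue G P V y b := fun b hb =>
    hVy.le.trans (iInf_le _ (⟨b, hb⟩ : G.actions y))
  have hae : qValue G P V y a ≤ V y := (ha.trans hVy.symm).le
  refine hy ((hg y a a.2).trans (le_trans (qValue_mono G P _ fun w hw => ?_) hae))
  by_contra hw'
  exact absurd (lt_of_optimal G P (hG y) a.2 hne hae hle hw) (not_lt.2 (hmin w hw'))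

/-- A function that no action improves and that is attained by given actions is a solution. -/
lemma isSolution_of_le [Finite X] (hG : ∀ x, P.rate * P.cFlc ≤ G.cost x / G.length x)
    {g : X → ℝ≥0∞} {π : X → Option (Action X)} (h0 : g goal = 0)
    (hg : ∀ x, ∀ a ∈ G.actions x, g x ≤ qValue G P g x a) (hgoal : π goal = none)
    (htop : ∀ x, g x = ⊤ → π x = none)
    (hact : ∀ x, x ≠ goal → g x ≠ ⊤ → ∃ a ∈ G.actions x, π x = some a ∧ qValue G P g x a ≤ g x) :
    IsSolution G P goal g π := by
  have hpol : IsPolicy G fun _ => π := by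
    intro h x a ha
    by_cases hx : x = goal
    · simp [hx, hgoal] at ha
    by_cases hgx : g x = ⊤
    · simp [htop x hgx] at ha
    obtain ⟨b, hb, hb', -⟩ := hact x hx hgx
    simp only [hb', Option.some.injEq] at ha
    exact ha ▸ hb
  -- Since the chosen actions cost at most `g`, induction on the horizon bounds every truncated cost
  -- by `g`; this settles the upper bound.
  have hle : ∀ N h x, stepCost G P goal (fun _ => π) N h x ≤ g x := by
    intro N
    induction N with
    | zero => simp [stepCost]
    | succ N ih =>
      intro h x
      by_cases hgx : g x = ⊤
      · simp [hgx]
      rw [stepCost]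
      split_ifs with hx
      · exact zero_le
      · obtain ⟨b, hb, hb', hb''⟩ := hact x hx hgx
        rw [hb']
        refine le_trans ?_ hb''
        exact List.sum_le_sum fun o _ => by gcongr; exact ih _ _
  have hexp : ∀ x, expectedCost G P goal (fun _ => π) x = g x := fun x =>
    le_antisymm (iSup_le fun N => hle N [] x) (le_expectedCost hG h0 hg hpol x)
  refine ⟨fun x => le_antisymm ?_ ?_, h0, fun x hx => le_antisymm ?_ ?_, hgoal, htop, ?_, hexp⟩
  · exact le_iInf fun π' => le_expectedCost hG h0 hg π'.2 x
  · exact (iInf_le _ ⟨_, hpol⟩).trans (hexp x).le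
  · exact le_iInf₂ fun a ha => hg x a ha
  · by_cases hgx : g x = ⊤
    · simp [hgx]
    obtain ⟨b, hb, -, hb''⟩ := hact x hx hgx
    exact (iInf₂_le b hb).trans hb''
  · intro x hx hgx
    obtain ⟨b, hb, hb', hb''⟩ := hact x hx hgx
    exact ⟨b, hb, hb', fun c hc => hb''.trans (hg x c hc)⟩

end Bellman

/-! ## The invariant of the algorithm -/

section Router

variable {X : Type*} [DecidableEq X]

/-- The invariant of the algorithm: the cells in `D` have been removed from the queue, and no
action with targets in `D'` improves the values. -/
structure RouterInv (G : LaneGraph X) (P : Params) (goal : X) (D D' : Finset X)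
    (s : RouterState X) : Prop where
  g_goal : s.g goal = 0
  act_goal : s.act goal = none
  ne_top_iff : ∀ x, s.g x ≠ ⊤ ↔ x ∈ D ∨ x ∈ s.queue
  notMem_queue : ∀ x ∈ D, x ∉ s.queue
  le : ∀ y ∈ D, ∀ x ∉ D, s.g y ≤ s.g x
  act_some : ∀ x, x ≠ goal → s.g x ≠ ⊤ →
    ∃ a ∈ G.actions x, s.act x = some a ∧ qValue G P s.g x a ≤ s.g x
  act_none : ∀ x, s.g x = ⊤ → s.act x = none
  closed : ∀ x, ∀ a ∈ G.actions x, (∀ y ∈ a.targets, y ∈ D') → s.g x ≤ qValue G P s.g x a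

variable {G : LaneGraph X} {P : Params} {goal : X} {D D' : Finset X} {s : RouterState X}

lemma RouterInv.init : RouterInv G P goal ∅ ∅ (routerInit goal) where
  g_goal := by simp [routerInit]
  act_goal := rfl
  ne_top_iff x := by
    by_cases h : x = goal
    · simp [routerInit, h]
    · simp [routerInit, h]
  notMem_queue := by simp
  le := by simp
  act_some x hx h := by simp [routerInit, hx] at h
  act_none _ _ := rfl
  closed x a _ h := by
    exfalso
    obtain ⟨y, hy⟩ : ∃ y, y ∈ a.targets := by
      cases a <;> exact ⟨_, List.mem_cons_self⟩
    simpa using h y hy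

/-- With an empty queue a cell outside `D` has value `⊤`, so an action with such a target cannot
improve anything, and the others are covered by `closed`. -/
lemma RouterInv.isSolution [Finite X] (hG : ∀ x, P.rate * P.cFlc ≤ G.cost x / G.length x)
    (h : RouterInv G P goal D D s) (hs : s.queue = ∅) : IsSolution G P goal s.g s.act := by
  refine isSolution_of_le hG h.g_goal (fun x a ha => ?_) h.act_goal h.act_none h.act_some
  by_cases hD : ∀ y ∈ a.targets, y ∈ D
  · exact h.closed x a ha hD
  · push Not at hD
    obtain ⟨y, hy, hyD⟩ := hD
    have : s.g y = ⊤ := by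
      by_contra hne
      have := (h.ne_top_iff y).1 hne
      simp [hyD, hs] at this
    rw [qValue_eq_top G P hy this]
    exact le_top

/-- Removing a cell of minimal value from the queue. -/
lemma RouterInv.remove {z : X} (h : RouterInv G P goal D D s) (hz : z ∈ s.queue)
    (hmin : ∀ y ∈ s.queue, s.g z ≤ s.g y) :
    RouterInv G P goal (insert z D) D { s with queue := s.queue.erase z } where
  g_goal := h.g_goal
  act_goal := h.act_goal
  ne_top_iff x := by
    rw [h.ne_top_iff x]
    by_cases hx : x = z <;> simp [hx, hz]
  notMem_queue x hx := by
    have := h.notMem_queue x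
    rw [Finset.mem_insert] at hx
    rw [Finset.mem_erase]
    tauto
  le y hy x hx := by
    simp only [Finset.mem_insert, not_or] at hx hy
    rcases hy with rfl | hy
    · by_cases hxq : x ∈ s.queue
      · exact hmin x hxq
      · have : s.g x = ⊤ := by
          by_contra hne
          have := (h.ne_top_iff x).1 hne
          tauto
        exact this ▸ le_top
    · exact h.le y hy x hx.2
  act_some := h.act_some
  act_none := h.act_none
  closed := h.closed

lemma RouterInv.le_removed {z : X} (h : RouterInv G P goal D D s) (hz : z ∈ s.queue) :
    ∀ y ∈ insert z D, s.g y ≤ s.g z := by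
  intro y hy
  rw [Finset.mem_insert] at hy
  rcases hy with rfl | hy
  · exact le_rfl
  · exact h.le y hy z fun hzD => h.notMem_queue z hzD hz

lemma relax_g_le (c : X × Action X) (x : X) : (relax G P s c).g x ≤ s.g x := by
  unfold relax
  split_ifs with h
  · by_cases hx : x = c.1
    · subst hx
      simpa using h.le
    · simp [hx]
  · exact le_rfl

/-- The heart of the label-setting argument. If no target is better than `z`, the traversal cost
gives the claim. Otherwise the action is a lane change whose other target is better, hence was
removed earlier. Staying or forcing towards that target has then been taken into account in `g x`,
so the improvement also beats that action. -/
lemma RouterInv.lt_qValue (hG : ∀ x, P.rate * P.cFlc ≤ G.cost x / G.length x) {z : X}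
    (h : RouterInv G P goal (insert z D) D s) {x : X} {a : Action X}
    (ha : a ∈ G.actions x) (hza : z ∈ a.targets) (hlt : qValue G P s.g x a < s.g x) :
    s.g z < qValue G P s.g x a := by
  have hzt : s.g z ≠ ⊤ := (h.ne_top_iff z).2 (by simp)
  have hge : ∀ y, y ∉ D → s.g z ≤ s.g y := fun y hy => by
    by_cases hyz : y = z
    · rw [hyz]
    · exact h.le z (by simp) y (by simp [hyz, hy])
  cases a with
  | stay s' =>
    simp only [Action.targets, List.mem_cons, List.not_mem_nil, or_false] at hza
    exact LaneRouting.lt_qValue G P hzt (by simp [Action.targets, hza])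
  | forced m t =>
    simp only [Action.targets, List.mem_cons, List.not_mem_nil, or_false] at hza
    exact LaneRouting.lt_qValue G P hzt (by simp [Action.targets, hza])
  | change m w t =>
    simp only [Action.targets, List.mem_cons, List.not_mem_nil, or_false] at hza
    obtain ⟨h1, h2, h3⟩ := ha
    rcases hza with rfl | rfl
    · by_cases hw : s.g z ≤ s.g w
      · exact LaneRouting.lt_qValue G P hzt (by simp [Action.targets, hw])
      · have hwD : w ∈ D := by
          by_contra hwD
          -- Here `z` is the success target and the failure target is better: the change is no
          -- better than staying, so it cannot improve.
          exact hw (hge w hwD)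
        have := h.closed x (.stay w) h2 (by simp [Action.targets, hwD])
        exact absurd (hlt.trans_le (this.trans
          (qValue_stay_le_qValue_change G P m (not_le.1 hw).le))) (lt_irrefl _)
    · by_cases ht : s.g z ≤ s.g t
      · exact LaneRouting.lt_qValue G P hzt (by simp [Action.targets, ht])
      · have htD : t ∈ D := by
          by_contra htD
          exact ht (hge t htD)
        -- Here `z` is the failure target: improving on `g x` means beating the forced change, and
        -- the cost condition applies.
        have := h.closed x (.forced m t) ⟨h1, h3⟩ (by simp [Action.targets, htD])
        exact lt_qValue_change_of_le_forced G P hzt ((h.ne_top_iff t).2 (by simp [htD])) (hG x)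
          (hlt.le.trans this)

/-- A new value exceeds `g z`, which is maximal among the removed cells, so it cannot improve any of
them. -/
lemma RouterInv.relax_g_eq (hG : ∀ x, P.rate * P.cFlc ≤ G.cost x / G.length x) {z : X}
    (h : RouterInv G P goal (insert z D) D s) (hmax : ∀ y ∈ insert z D, s.g y ≤ s.g z)
    {c : X × Action X} (ha : c.2 ∈ G.actions c.1) (hza : z ∈ c.2.targets) {y : X}
    (hy : y ∈ insert z D) : (relax G P s c).g y = s.g y := by
  unfold relax
  split_ifs with hlt
  · have hyc : y ≠ c.1 := by
      rintro rfl
      exact absurd ((h.lt_qValue hG ha hza hlt).trans hlt) (not_lt.2 (hmax _ hy))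
    simp [hyc]
  · rfl

lemma RouterInv.relax (hG : ∀ x, P.rate * P.cFlc ≤ G.cost x / G.length x) {z : X}
    (h : RouterInv G P goal (insert z D) D s) (hmax : ∀ y ∈ insert z D, s.g y ≤ s.g z)
    {c : X × Action X} (ha : c.2 ∈ G.actions c.1) (hza : z ∈ c.2.targets) :
    RouterInv G P goal (insert z D) D (relax G P s c) := by
  have heq : ∀ y ∈ insert z D, (LaneRouting.relax G P s c).g y = s.g y := fun y hy =>
    h.relax_g_eq hG hmax ha hza hy
  have hle := relax_g_le (G := G) (P := P) (s := s) c
  by_cases hlt : qValue G P s.g c.1 c.2 < s.g c.1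
  swap
  · have : LaneRouting.relax G P s c = s := by simp [LaneRouting.relax, hlt]
    rwa [this]
  have hcD : c.1 ∉ insert z D := fun hc =>
    absurd ((h.lt_qValue hG ha hza hlt).trans hlt) (not_lt.2 (hmax _ hc))
  have hcg : c.1 ≠ goal := by
    intro hc
    rw [hc, h.g_goal] at hlt
    exact absurd hlt not_lt_zero
  have hzlt := h.lt_qValue hG ha hza hlt
  have hdef : LaneRouting.relax G P s c =
      { g := Function.update s.g c.1 (qValue G P s.g c.1 c.2)
        act := Function.update s.act c.1 (some c.2)
        queue := insert c.1 s.queue } := by simp [LaneRouting.relax, hlt]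
  have hg : ∀ y, y ≠ c.1 → (LaneRouting.relax G P s c).g y = s.g y := fun y hy => by
    simp [hdef, hy]
  have hgc : (LaneRouting.relax G P s c).g c.1 = qValue G P s.g c.1 c.2 := by simp [hdef]
  have hact : ∀ y, y ≠ c.1 → (LaneRouting.relax G P s c).act y = s.act y := fun y hy => by
    simp [hdef, hy]
  have hactc : (LaneRouting.relax G P s c).act c.1 = some c.2 := by simp [hdef]
  have hq : (LaneRouting.relax G P s c).queue = insert c.1 s.queue := by simp [hdef]
  refine ⟨?_, ?_, ?_, ?_, ?_, ?_, ?_, ?_⟩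
  · rw [hg _ hcg.symm, h.g_goal]
  · rw [hact _ hcg.symm, h.act_goal]
  · intro x
    by_cases hx : x = c.1
    · subst hx
      rw [hgc, hq]
      simp [hlt.ne_top]
    · rw [hg x hx, h.ne_top_iff x, hq]
      simp [hx]
  · intro x hx
    have hxc : x ≠ c.1 := fun hxc => hcD (hxc ▸ hx)
    rw [hq, Finset.mem_insert]
    exact not_or.2 ⟨hxc, h.notMem_queue x hx⟩
  · intro y hy x hx
    rw [heq y hy]
    by_cases hxc : x = c.1
    · rw [hxc, hgc]
      exact (hmax y hy).trans hzlt.le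
    · rw [hg x hxc]
      exact h.le y hy x hx
  · intro x hx hxt
    by_cases hxc : x = c.1
    · subst hxc
      -- The action was evaluated before the update, and lowering `g` can lower its value further;
      -- hence the invariant asks only for an inequality.
      exact ⟨c.2, ha, hactc, (qValue_mono G P _ fun y _ => hle y).trans hgc.ge⟩
    · rw [hg x hxc] at hxt ⊢
      obtain ⟨a, ha1, ha2, ha3⟩ := h.act_some x hx hxt
      exact ⟨a, ha1, (hact x hxc).trans ha2, (qValue_mono G P _ fun y _ => hle y).trans ha3⟩
  · intro x hx
    by_cases hxc : x = c.1
    · rw [hxc, hgc] at hx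
      exact absurd hx hlt.ne_top
    · rw [hact x hxc]
      exact h.act_none x (hg x hxc ▸ hx)
  · intro x a ha' hD
    rw [qValue_congr G P a fun y hy => heq y (Finset.mem_insert_of_mem (hD y hy))]
    exact (hle x).trans (h.closed x a ha' hD)

/-- Processing actions that can lead to the removed cell. -/
lemma RouterInv.foldl_relax (hG : ∀ x, P.rate * P.cFlc ≤ G.cost x / G.length x) {z : X}
    (h : RouterInv G P goal (insert z D) D s) (hmax : ∀ y ∈ insert z D, s.g y ≤ s.g z)
    {l : List (X × Action X)} (hl : ∀ c ∈ l, c.2 ∈ G.actions c.1 ∧ z ∈ c.2.targets) :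
    RouterInv G P goal (insert z D) D (l.foldl (LaneRouting.relax G P) s) ∧
      (∀ x, (l.foldl (LaneRouting.relax G P) s).g x ≤ s.g x) ∧
      (∀ y ∈ insert z D, (l.foldl (LaneRouting.relax G P) s).g y = s.g y) ∧
      ∀ c ∈ l, (∀ y ∈ c.2.targets, y ∈ insert z D) →
        (l.foldl (LaneRouting.relax G P) s).g c.1 ≤ qValue G P s.g c.1 c.2 := by
  induction l generalizing s with
  | nil => simpa using h
  | cons c l ih =>
    obtain ⟨hc1, hc2⟩ := hl c (by simp)
    have heq : ∀ y ∈ insert z D, (LaneRouting.relax G P s c).g y = s.g y := fun y hy =>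
      h.relax_g_eq hG hmax hc1 hc2 hy
    obtain ⟨i1, i2, i3, i4⟩ := ih (h.relax hG hmax hc1 hc2)
      (fun y hy => by rw [heq y hy, heq z (by simp)]; exact hmax y hy)
      (fun c hc => hl c (by simp [hc]))
    rw [List.foldl_cons]
    refine ⟨i1, fun x => (i2 x).trans (relax_g_le c x), fun y hy => (i3 y hy).trans (heq y hy), ?_⟩
    intro c' hc' ht
    rw [List.mem_cons] at hc'
    rcases hc' with rfl | hc'
    · refine (i2 _).trans ?_
      unfold LaneRouting.relax
      split_ifs with hlt
      · simp
      · exact not_lt.1 hlt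
    · rw [← qValue_congr G P c'.2 fun y hy => heq y (ht y hy)]
      exact i4 c' hc' ht

lemma RouterInv.close {z : X} (h : RouterInv G P goal D D' s)
    (hz : ∀ x, ∀ a ∈ G.actions x, z ∈ a.targets → (∀ y ∈ a.targets, y ∈ insert z D') →
      s.g x ≤ qValue G P s.g x a) :
    RouterInv G P goal D (insert z D') s :=
  { h with
    closed := fun x a ha hD => by
      by_cases hza : z ∈ a.targets
      · exact hz x a ha hza hD
      · refine h.closed x a ha fun y hy => ?_
        have := hD y hy
        rw [Finset.mem_insert] at this
        rcases this with rfl | h'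
        · exact absurd hy hza
        · exact h' }

lemma RouterInv.step (hG : ∀ x, P.rate * P.cFlc ≤ G.cost x / G.length x) {s' : RouterState X}
    (h : RouterInv G P goal D D s) (hs : RouterStep G P s s') :
    ∃ z ∉ D, RouterInv G P goal (insert z D) (insert z D) s' := by
  obtain ⟨z, hz, hmin, l, -, hl, rfl⟩ := hs
  simp only [transProb_pos_iff] at hl
  refine ⟨z, fun hzD => h.notMem_queue z hzD hz, ?_⟩
  obtain ⟨i1, i2, i3, i4⟩ := (h.remove hz hmin).foldl_relax hG (h.le_removed hz)
    (l := l) (fun c hc => (hl c).1 hc)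
  refine i1.close fun x a ha hza ht => ?_
  -- All targets are removed cells, so the action has the same value before and after the whole
  -- list, whatever its order.
  rw [qValue_congr G P a fun y hy => i3 y (ht y hy)]
  exact i4 (x, a) ((hl (x, a)).2 ⟨ha, hza⟩) ht

/-! ### Number of iterations, termination and correctness -/

lemma RouterRun.exists_inv (hG : ∀ x, P.rate * P.cFlc ≤ G.cost x / G.length x) {k : ℕ}
    (h : RouterRun G P goal k s) : ∃ D : Finset X, D.card = k ∧ RouterInv G P goal D D s := by
  induction h with
  | init => exact ⟨∅, rfl, .init⟩
  | step _ hs ih =>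
    obtain ⟨D, rfl, hD⟩ := ih
    obtain ⟨z, hz, hi⟩ := hD.step hG hs
    exact ⟨_, Finset.card_insert_of_notMem hz, hi⟩

lemma RouterStep.exists [Finite X] (hs : s.queue.Nonempty) : ∃ s', RouterStep G P s s' := by
  obtain ⟨z, hz, hmin⟩ := Finset.exists_min_image s.queue s.g hs
  set S : Set (X × Action X) := {c | c.2 ∈ G.actions c.1 ∧ 0 < transProb G P c.1 c.2 z}
  have hS : S.Finite := Set.toFinite S
  exact ⟨_, z, hz, hmin, hS.toFinset.toList, Finset.nodup_toList _, by simp [S], rfl⟩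

lemma RouterRun.le_card [Fintype X] (hG : ∀ x, P.rate * P.cFlc ≤ G.cost x / G.length x) {k : ℕ}
    (h : RouterRun G P goal k s) : k ≤ Fintype.card X := by
  obtain ⟨D, rfl, -⟩ := h.exists_inv hG
  exact Finset.card_le_univ D

/-- A nonempty queue always permits another step, so without a halting run there would be one longer
than the number of cells. -/
lemma RouterRun.exists_halting [Fintype X]
    (hG : ∀ x, P.rate * P.cFlc ≤ G.cost x / G.length x) :
    ∃ k s, RouterRun G P goal k s ∧ s.queue = ∅ := by
  by_contra! h
  have key : ∀ k, ∃ s, RouterRun G P goal k s := by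
    intro k
    induction k with
    | zero => exact ⟨_, .init⟩
    | succ k ih =>
      obtain ⟨s, hs⟩ := ih
      obtain ⟨s', hs'⟩ := RouterStep.exists (G := G) (P := P)
        (Finset.nonempty_iff_ne_empty.2 (h k s hs).ne_empty)
      exact ⟨s', hs.step hs'⟩
  obtain ⟨s, hs⟩ := key (Fintype.card X + 1)
  have := hs.le_card hG
  omega

lemma RouterRun.isSolution [Fintype X] (hG : ∀ x, P.rate * P.cFlc ≤ G.cost x / G.length x)
    {k : ℕ} (h : RouterRun G P goal k s) (hs : s.queue = ∅) : IsSolution G P goal s.g s.act := by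
  obtain ⟨D, -, hD⟩ := h.exists_inv hG
  exact hD.isSolution hG hs

end Router

/-! ## Processing only the actions that lead to best successors -/

section Best

variable {X : Type*}

lemma LaneGraph.isNeighbor_comm (G : LaneGraph X) {x m : X} :
    G.IsNeighbor x m ↔ G.IsNeighbor m x := by
  unfold LaneGraph.IsNeighbor
  rw [← G.lnb_iff_rnb, G.lnb_iff_rnb m x]
  exact or_comm

/-- The lane changes between `m` and its neighbor `o` that get available when `z` becomes the best
successor of `m`; the best successors are given by `b`. -/
def neighborPairs (z m : X) (b : X → Option X) : Option X → List (X × Action X)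
  | none => []
  | some y => (y, .forced m z) ::
      match b y with
      | none => []
      | some w => [(y, .change m w z), (m, .change y z w)]

/-- All actions that get available when `z` becomes the best successor of `m`. -/
def cellPairs (G : LaneGraph X) (z m : X) (b : X → Option X) : List (X × Action X) :=
  (m, .stay z) :: (neighborPairs z m b (G.lnb m) ++ neighborPairs z m b (G.rnb m))

/-- The best successors `b` are successors in `D`, and no action that leads to best successors
only improves the values. -/
structure BestInv (G : LaneGraph X) (P : Params) (D : Finset X) (s : RouterState X)
    (b : X → Option X) : Prop where
  mem : ∀ m y, b m = some y → y ∈ D ∧ y ∈ G.succ m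
  le_stay : ∀ x y, b x = some y → s.g x ≤ qValue G P s.g x (.stay y)
  le_forced : ∀ x m t, G.IsNeighbor x m → b m = some t → s.g x ≤ qValue G P s.g x (.forced m t)
  le_change : ∀ x m y t, G.IsNeighbor x m → b x = some y → b m = some t →
    s.g x ≤ qValue G P s.g x (.change m y t)

/-- The best successor of `m` is at least as good as `y`. -/
def Dominated (s : RouterState X) (b : X → Option X) (m y : X) : Prop :=
  ∃ y', b m = some y' ∧ s.g y' ≤ s.g y

variable {G : LaneGraph X} {P : Params} {goal : X} {D : Finset X} {s : RouterState X}
  {b : X → Option X} {z : X} {M : Set X}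

lemma mem_neighborPairs {c : X × Action X} {m : X} {o : Option X} :
    c ∈ neighborPairs z m b o ↔ ∃ y, o = some y ∧ (c = (y, .forced m z) ∨
      ∃ w, b y = some w ∧ (c = (y, .change m w z) ∨ c = (m, .change y z w))) := by
  cases o with
  | none => simp [neighborPairs]
  | some y => cases hb : b y <;> simp [neighborPairs, hb]

lemma mem_cellPairs {c : X × Action X} {m : X} :
    c ∈ cellPairs G z m b ↔ c = (m, .stay z) ∨ ∃ y, G.IsNeighbor m y ∧ (c = (y, .forced m z) ∨
      ∃ w, b y = some w ∧ (c = (y, .change m w z) ∨ c = (m, .change y z w))) := by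
  simp only [cellPairs, List.mem_cons, List.mem_append, mem_neighborPairs, LaneGraph.IsNeighbor,
    or_and_right, exists_or]

/-- Replacing each target by the best successor of the lane it belongs to gives an available action
of no larger value, and that one is covered by `BestInv`. -/
lemma qValue_le_of_dominated {x : X} {a : Action X} (hb : BestInv G P D s b)
    (ha : a ∈ G.actions x)
    (hdom : ∀ y ∈ a.targets, ∀ m ∈ G.pred y, Dominated s b m y) :
    s.g x ≤ qValue G P s.g x a := by
  cases a with
  | stay y =>
    obtain ⟨y', h1, h2⟩ := hdom y (by simp [Action.targets]) x ((G.succ_iff_pred _ _).1 ha)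
    refine (hb.le_stay x y' h1).trans ?_
    rw [qValue_stay, qValue_stay]
    gcongr
  | forced m t =>
    obtain ⟨ha1, ha2⟩ := ha
    obtain ⟨t', h1, h2⟩ := hdom t (by simp [Action.targets]) m ((G.succ_iff_pred _ _).1 ha2)
    refine (hb.le_forced x m t' ha1 h1).trans ?_
    rw [qValue_forced, qValue_forced]
    gcongr
  | change m y t =>
    obtain ⟨ha1, ha2, ha3⟩ := ha
    obtain ⟨y', h1, h2⟩ := hdom y (by simp [Action.targets]) x ((G.succ_iff_pred _ _).1 ha2)
    obtain ⟨t', h3, h4⟩ := hdom t (by simp [Action.targets]) m ((G.succ_iff_pred _ _).1 ha3)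
    refine (hb.le_change x m y' t' ha1 h1 h3).trans ?_
    rw [qValue_change, qValue_change]
    gcongr

variable [DecidableEq X]

/-- If `m` has no best successor yet, then `z` becomes its best successor. -/
def cellStep (G : LaneGraph X) (P : Params) (z : X) (p : RouterState X × (X → Option X)) (m : X) :
    RouterState X × (X → Option X) :=
  if p.2 m = none then
    ((cellPairs G z m (Function.update p.2 m (some z))).foldl (relax G P) p.1,
      Function.update p.2 m (some z))
  else p

/-- The invariant of the main loop. -/
structure MainInv (G : LaneGraph X) (P : Params) (goal : X) (D : Finset X) (s : RouterState X)
    (b : X → Option X) : Prop where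
  router : RouterInv G P goal D D s
  best : BestInv G P D s b
  dominated : ∀ y ∈ D, ∀ m ∈ G.pred y, Dominated s b m y

/-- The invariant of the loop over the predecessors of the removed cell `z`; the set `M` consists
of the predecessors considered so far. -/
structure ScanInv (G : LaneGraph X) (P : Params) (goal : X) (D : Finset X) (z : X) (M : Set X)
    (s : RouterState X) (b : X → Option X) : Prop where
  router : RouterInv G P goal (insert z D) D s
  le : ∀ y ∈ insert z D, s.g y ≤ s.g z
  best : BestInv G P (insert z D) s b
  dominated : ∀ y ∈ D, ∀ m ∈ G.pred y, Dominated s b m y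
  scanned : ∀ m ∈ M, Dominated s b m z

lemma MainInv.init : MainInv G P goal ∅ (routerInit goal) fun _ => none where
  router := .init
  best := ⟨by simp, by simp, by simp, by simp⟩
  dominated := by simp

lemma MainInv.remove (h : MainInv G P goal D s b) (hz : z ∈ s.queue)
    (hmin : ∀ y ∈ s.queue, s.g z ≤ s.g y) :
    ScanInv G P goal D z ∅ { s with queue := s.queue.erase z } b where
  router := h.router.remove hz hmin
  le := h.router.le_removed hz
  best :=
    { mem := fun m y hm => by simp [h.best.mem m y hm]
      le_stay := h.best.le_stay
      le_forced := h.best.le_forced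
      le_change := h.best.le_change }
  dominated := h.dominated
  scanned := by simp

/-- Domination at all predecessors closes the values under all actions into removed cells, although
only few were relaxed. Thus `RouterInv` serves the fast program too. -/
lemma ScanInv.mainInv (h : ScanInv G P goal D z M s b) (hM : ∀ m ∈ G.pred z, m ∈ M) :
    MainInv G P goal (insert z D) s b := by
  have hdom : ∀ y ∈ insert z D, ∀ m ∈ G.pred y, Dominated s b m y := by
    intro y hy m hm
    rw [Finset.mem_insert] at hy
    rcases hy with rfl | hy
    · exact h.scanned m (hM m hm)
    · exact h.dominated y hy m hm
  exact ⟨h.router.close fun x a ha _ ht =>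
    qValue_le_of_dominated h.best ha fun y hy => hdom y (ht y hy), h.best, hdom⟩

/-- A best successor chosen earlier was removed no later than `z` and thus dominates it. If there is
none, every action newly made of best successors has `z` as a target, so relaxing these few leaves
the removed values fixed. -/
lemma ScanInv.cellStep (hG : ∀ x, P.rate * P.cFlc ≤ G.cost x / G.length x)
    (h : ScanInv G P goal D z M s b) {m : X} (hm : m ∈ G.pred z) :
    ScanInv G P goal D z (insert m M) (cellStep G P z (s, b) m).1 (cellStep G P z (s, b) m).2 := by
  unfold LaneRouting.cellStep
  split_ifs with hbm
  swap
  · obtain ⟨y, hy⟩ := Option.ne_none_iff_exists'.1 hbm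
    dsimp only at hy
    refine ⟨h.router, h.le, h.best, h.dominated, fun m' hm' => ?_⟩
    rw [Set.mem_insert_iff] at hm'
    rcases hm' with rfl | hm'
    · exact ⟨y, hy, h.le y (h.best.mem _ _ hy).1⟩
    · exact h.scanned m' hm'
  dsimp only at hbm ⊢
  -- The pairs are formed from the updated table, which also covers a cell that is its own neighbor.
  set b' := Function.update b m (some z) with hb'
  have hb'm : b' m = some z := by simp [hb']
  have hb'ne : ∀ x, x ≠ m → b' x = b x := fun x hx => by simp [hb', hx]
  have hzm : z ∈ G.succ m := (G.succ_iff_pred _ _).2 hm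
  have hmem : ∀ x y, b' x = some y → y ∈ insert z D ∧ y ∈ G.succ x := by
    intro x y hxy
    by_cases hx : x = m
    · subst hx
      rw [hb'm, Option.some.injEq] at hxy
      subst hxy
      simp [hzm]
    · rw [hb'ne x hx] at hxy
      exact h.best.mem x y hxy
  obtain ⟨i1, i2, i3, i4⟩ := h.router.foldl_relax hG h.le (l := cellPairs G z m b') (by
    intro c hc
    rw [mem_cellPairs] at hc
    rcases hc with rfl | ⟨y, hy, rfl | ⟨w, hw, rfl | rfl⟩⟩
    · exact ⟨hzm, by simp [Action.targets]⟩
    · exact ⟨⟨G.isNeighbor_comm.1 hy, hzm⟩, by simp [Action.targets]⟩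
    · exact ⟨⟨G.isNeighbor_comm.1 hy, (hmem y w hw).2, hzm⟩, by simp [Action.targets]⟩
    · exact ⟨⟨hy, hzm, (hmem y w hw).2⟩, by simp [Action.targets]⟩)
  set s' := (cellPairs G z m b').foldl (relax G P) s
  have hmono : ∀ x a, (∀ y ∈ a.targets, y ∈ insert z D) → s.g x ≤ qValue G P s.g x a →
      s'.g x ≤ qValue G P s'.g x a := fun x a ht hx => by
    rw [qValue_congr G P a fun y hy => i3 y (ht y hy)]
    exact (i2 x).trans hx
  have hnew : ∀ x a, (∀ y ∈ a.targets, y ∈ insert z D) → (x, a) ∈ cellPairs G z m b' →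
      s'.g x ≤ qValue G P s'.g x a := fun x a ht hx => by
    rw [qValue_congr G P a fun y hy => i3 y (ht y hy)]
    exact i4 (x, a) hx ht
  have hdom : ∀ x y, y ∈ insert z D → Dominated s b x y → Dominated s' b' x y := by
    rintro x y hy ⟨y', h1, h2⟩
    have hx : x ≠ m := by
      rintro rfl
      simp [hbm] at h1
    refine ⟨y', by rw [hb'ne x hx, h1], ?_⟩
    rw [i3 y hy, i3 y' (h.best.mem x y' h1).1]
    exact h2
  refine ⟨i1, fun y hy => ?_, ⟨hmem, ?_, ?_, ?_⟩, fun y hy x hx =>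
    hdom x y (Finset.mem_insert_of_mem hy) (h.dominated y hy x hx), ?_⟩
  · rw [i3 y hy, i3 z (by simp)]
    exact h.le y hy
  · intro x y hxy
    have ht : ∀ w ∈ (Action.stay y).targets, w ∈ insert z D := by
      simpa [Action.targets] using (hmem x y hxy).1
    by_cases hx : x = m
    · subst hx
      rw [hb'm, Option.some.injEq] at hxy
      subst hxy
      exact hnew _ _ ht (mem_cellPairs.2 (Or.inl rfl))
    · exact hmono _ _ ht (h.best.le_stay x y (hb'ne x hx ▸ hxy))
  · intro x k t hxk hkt
    have ht : ∀ w ∈ (Action.forced k t).targets, w ∈ insert z D := by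
      simpa [Action.targets] using (hmem k t hkt).1
    by_cases hk : k = m
    · subst hk
      rw [hb'm, Option.some.injEq] at hkt
      subst hkt
      exact hnew _ _ ht (mem_cellPairs.2 (Or.inr ⟨x, G.isNeighbor_comm.1 hxk, Or.inl rfl⟩))
    · exact hmono _ _ ht (h.best.le_forced x k t hxk (hb'ne k hk ▸ hkt))
  · intro x k y t hxk hxy hkt
    have ht : ∀ w ∈ (Action.change k y t).targets, w ∈ insert z D := by
      simpa [Action.targets] using And.intro (Finset.mem_insert.1 (hmem k t hkt).1)
        (Finset.mem_insert.1 (hmem x y hxy).1)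
    by_cases hk : k = m
    · subst hk
      rw [hb'm, Option.some.injEq] at hkt
      subst hkt
      exact hnew _ _ ht (mem_cellPairs.2 (Or.inr ⟨x, G.isNeighbor_comm.1 hxk, Or.inr
        ⟨y, hxy, Or.inl rfl⟩⟩))
    by_cases hx : x = m
    · subst hx
      rw [hb'm, Option.some.injEq] at hxy
      subst hxy
      exact hnew _ _ ht (mem_cellPairs.2 (Or.inr ⟨k, hxk, Or.inr ⟨t, hkt, Or.inr rfl⟩⟩))
    · exact hmono _ _ ht (h.best.le_change x k y t hxk (hb'ne x hx ▸ hxy) (hb'ne k hk ▸ hkt))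
  · intro x hx
    rw [Set.mem_insert_iff] at hx
    rcases hx with rfl | hx
    · exact ⟨z, hb'm, le_rfl⟩
    · exact hdom x z (by simp) (h.scanned x hx)

end Best

/-! ## Reasoning about programs -/

/-- The memory after an assignment to an integer register. -/
def Memory.setNat (m : Memory) (r v : ℕ) : Memory :=
  { m with natReg := Function.update m.natReg r v }

/-- The memory after an assignment to a real register. -/
def Memory.setReal (m : Memory) (r : ℕ) (v : ℝ) : Memory :=
  { m with realReg := Function.update m.realReg r v }

/-- The memory after an assignment to an entry of an integer array. -/
def Memory.storeNat (m : Memory) (a i v : ℕ) : Memory :=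
  { m with natArr := Function.update m.natArr a (Function.update (m.natArr a) i v) }

/-- The memory after an assignment to an entry of a real array. -/
def Memory.storeReal (m : Memory) (a i : ℕ) (v : ℝ) : Memory :=
  { m with realArr := Function.update m.realArr a (Function.update (m.realArr a) i v) }

section MemoryLemmas

variable (m : Memory) (a i r v : ℕ) (u : ℝ)

@[simp] lemma Memory.setNat_natReg (r' : ℕ) :
    (m.setNat r v).natReg r' = if r' = r then v else m.natReg r' :=
  Function.update_apply ..

@[simp] lemma Memory.setNat_realReg : (m.setNat r v).realReg = m.realReg := rfl

@[simp] lemma Memory.setNat_natArr : (m.setNat r v).natArr = m.natArr := rfl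

@[simp] lemma Memory.setNat_realArr : (m.setNat r v).realArr = m.realArr := rfl

@[simp] lemma Memory.setReal_natReg : (m.setReal r u).natReg = m.natReg := rfl

@[simp] lemma Memory.setReal_realReg (r' : ℕ) :
    (m.setReal r u).realReg r' = if r' = r then u else m.realReg r' :=
  Function.update_apply ..

@[simp] lemma Memory.setReal_natArr : (m.setReal r u).natArr = m.natArr := rfl

@[simp] lemma Memory.setReal_realArr : (m.setReal r u).realArr = m.realArr := rfl

@[simp] lemma Memory.storeNat_natReg : (m.storeNat a i v).natReg = m.natReg := rfl

@[simp] lemma Memory.storeNat_realReg : (m.storeNat a i v).realReg = m.realReg := rfl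

@[simp] lemma Memory.storeNat_natArr (a' : ℕ) : (m.storeNat a i v).natArr a' =
    if a' = a then Function.update (m.natArr a) i v else m.natArr a' :=
  Function.update_apply ..

@[simp] lemma Memory.storeNat_realArr : (m.storeNat a i v).realArr = m.realArr := rfl

@[simp] lemma Memory.storeReal_natReg : (m.storeReal a i u).natReg = m.natReg := rfl

@[simp] lemma Memory.storeReal_realReg : (m.storeReal a i u).realReg = m.realReg := rfl

@[simp] lemma Memory.storeReal_natArr : (m.storeReal a i u).natArr = m.natArr := rfl

@[simp] lemma Memory.storeReal_realArr (a' : ℕ) : (m.storeReal a i u).realArr a' =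
    if a' = a then Function.update (m.realArr a) i u else m.realArr a' :=
  Function.update_apply ..

end MemoryLemmas

/-- Started in `m`, the program halts within `T` steps in a memory that satisfies `Q`. -/
def Halts (p : Program) (m : Memory) (T : ℕ) (Q : Memory → Prop) : Prop :=
  ∃ t m', Exec p m t m' ∧ t ≤ T ∧ Q m'

/-- The running time of a program in which each loop takes at most `w` steps. -/
def Program.bound (w : ℕ) : Program → ℕ
  | .skip => 1
  | .setNat _ e => e.time + 1
  | .setReal _ e => e.time + 1
  | .storeNat _ i e => i.time + e.time + 1
  | .storeReal _ i e => i.time + e.time + 1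
  | .seq p q => p.bound w + q.bound w
  | .ite b p q => b.time + max (p.bound w) (q.bound w)
  | .while _ _ => w

/-- This separates the constant `p.bound 1`, which depends on the code alone, from the loop time,
which depends on the input. -/
lemma Program.bound_le_mul {w : ℕ} (hw : 1 ≤ w) (p : Program) : p.bound w ≤ p.bound 1 * w := by
  induction p with
  | seq p q ihp ihq =>
    simp only [Program.bound]
    nlinarith
  | ite b p q ihp ihq =>
    simp only [Program.bound]
    have h1 := le_max_left (p.bound 1) (q.bound 1)
    have h2 := le_max_right (p.bound 1) (q.bound 1)
    have h3 : b.time ≤ b.time * w := Nat.le_mul_of_pos_right _ hw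
    rw [add_mul]
    refine add_le_add h3 (max_le ?_ ?_)
    · exact ihp.trans (by gcongr)
    · exact ihq.trans (by gcongr)
  | _ =>
    simp only [Program.bound]
    first
    | exact Nat.le_mul_of_pos_right _ hw
    | exact (one_mul w).ge

/-- Started in `m`, the program halts in a memory that satisfies `Q`, within the time bound for
programs in which each loop takes at most `w` steps. -/
def Runs (w : ℕ) (p : Program) (m : Memory) (Q : Memory → Prop) : Prop :=
  Halts p m (p.bound w) Q

section Rules

variable {p q : Program} {b : Test} {m : Memory} {T T₁ T₂ w : ℕ} {Q Q' : Memory → Prop}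

lemma Halts.mono (h : Halts p m T₁ Q) (hT : T₁ ≤ T₂) (hQ : ∀ m', Q m' → Q' m') :
    Halts p m T₂ Q' := by
  obtain ⟨t, m', h1, h2, h3⟩ := h
  exact ⟨t, m', h1, h2.trans hT, hQ m' h3⟩

lemma Halts.seq (h : Halts p m T₁ fun m' => Halts q m' T₂ Q) : Halts (.seq p q) m (T₁ + T₂) Q := by
  obtain ⟨t, m', h1, h2, t', m'', h3, h4, h5⟩ := h
  exact ⟨_, _, .seq h1 h3, add_le_add h2 h4, h5⟩

lemma Halts.while_done (hb : ¬ b.Holds m) (hQ : Q m) (hT : b.time ≤ T) :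
    Halts (.while b p) m T Q :=
  ⟨_, _, .while_done hb, hT, hQ⟩

lemma Halts.while_step (hb : b.Holds m) (h : Halts p m T₁ fun m' => Halts (.while b p) m' T₂ Q)
    (hT : b.time + T₁ + T₂ ≤ T) : Halts (.while b p) m T Q := by
  obtain ⟨t, m', h1, h2, t', m'', h3, h4, h5⟩ := h
  exact ⟨_, _, .while_step hb h1 h3, by omega, h5⟩

/-- A loop with an invariant that tells the number of iterations to come. -/
lemma Halts.while_count {I : ℕ → Memory → Prop} (hdone : ∀ m, I 0 m → ¬ b.Holds m)
    (hstep : ∀ k m, I (k + 1) m → b.Holds m ∧ Halts p m T (I k)) {k : ℕ} (hI : I k m) :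
    Halts (.while b p) m (k * (b.time + T) + b.time) (I 0) := by
  induction k generalizing m with
  | zero => exact .while_done (hdone m hI) hI (by simp)
  | succ k ih =>
    obtain ⟨hb, h⟩ := hstep k m hI
    exact .while_step hb (h.mono le_rfl fun m' hm' => ih hm') (by rw [add_mul]; omega)

lemma Runs.mono (h : Runs w p m Q) (hQ : ∀ m', Q m' → Q' m') : Runs w p m Q' :=
  Halts.mono h le_rfl hQ

lemma Runs.skip (h : Q m) : Runs w .skip m Q :=
  ⟨_, _, .skip m, le_rfl, h⟩

lemma Runs.setNat {r : ℕ} {e : NatExpr} (h : Q (m.setNat r (e.eval m))) :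
    Runs w (.setNat r e) m Q :=
  ⟨_, _, .setNat m r e, le_rfl, h⟩

lemma Runs.setReal {r : ℕ} {e : RealExpr} (h : Q (m.setReal r (e.eval m))) :
    Runs w (.setReal r e) m Q :=
  ⟨_, _, .setReal m r e, le_rfl, h⟩

lemma Runs.storeNat {a : ℕ} {i e : NatExpr} (h : Q (m.storeNat a (i.eval m) (e.eval m))) :
    Runs w (.storeNat a i e) m Q :=
  ⟨_, _, .storeNat m a i e, le_rfl, h⟩

lemma Runs.storeReal {a : ℕ} {i : NatExpr} {e : RealExpr}
    (h : Q (m.storeReal a (i.eval m) (e.eval m))) : Runs w (.storeReal a i e) m Q :=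
  ⟨_, _, .storeReal m a i e, le_rfl, h⟩

lemma Runs.seq (h : Runs w p m fun m' => Runs w q m' Q) : Runs w (.seq p q) m Q :=
  Halts.seq h

lemma Runs.ite (hp : b.Holds m → Runs w p m Q) (hq : ¬ b.Holds m → Runs w q m Q) :
    Runs w (.ite b p q) m Q := by
  by_cases hb : b.Holds m
  · obtain ⟨t, m', h1, h2, h3⟩ := hp hb
    exact ⟨_, _, .ite_pos hb h1, Nat.add_le_add_left (h2.trans (le_max_left _ _)) _, h3⟩
  · obtain ⟨t, m', h1, h2, h3⟩ := hq hb
    exact ⟨_, _, .ite_neg hb h1, Nat.add_le_add_left (h2.trans (le_max_right _ _)) _, h3⟩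

end Rules

/-! ## Tournament trees

The nodes of the tree are the numbers from `1` to `2 * n - 1`. The node `j < n` has the children
`2 * j` and `2 * j + 1`, and the leaf `n + i` belongs to the cell `i`. A node that contains `0` is
empty, and one that contains `i + 1` contains the cell `i`. -/

/-- The better one of the contents `l` and `r` of two nodes. -/
def winner (v : ℕ → ℝ) (l r : ℕ) : ℕ :=
  if l = 0 then r else if r = 0 then l else if v (r - 1) < v (l - 1) then r else l

/-- Each inner node contains the better one of the contents of its children. -/
def IsTournament (n : ℕ) (v : ℕ → ℝ) (T : ℕ → ℕ) : Prop :=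
  ∀ j, 1 ≤ j → j < n → T j = winner v (T (2 * j)) (T (2 * j + 1))

/-- The node `j` is a proper ancestor of the node `k`. -/
def Above (j k : ℕ) : Prop := ∃ d, j = k / 2 ^ (d + 1)

/-- The tournament is correct except possibly at the proper ancestors of `k`. -/
def IsTournamentExcept (n : ℕ) (v : ℕ → ℝ) (T : ℕ → ℕ) (k : ℕ) : Prop :=
  ∀ j, 1 ≤ j → j < n → ¬ Above j k → T j = winner v (T (2 * j)) (T (2 * j + 1))

section Tournament

variable {n : ℕ} {v v' : ℕ → ℝ} {T : ℕ → ℕ}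

lemma winner_mem (v : ℕ → ℝ) (l r : ℕ) : winner v l r = l ∨ winner v l r = r := by
  unfold winner
  split_ifs <;> simp

lemma winner_spec (v : ℕ → ℝ) {l r c : ℕ} (hc : c = l ∨ c = r) (h0 : c ≠ 0) :
    winner v l r ≠ 0 ∧ v (winner v l r - 1) ≤ v (c - 1) := by
  unfold winner
  rcases hc with rfl | rfl
  · rw [if_neg h0]
    split_ifs with h1 h2
    · exact ⟨h0, le_rfl⟩
    · exact ⟨h1, h2.le⟩
    · exact ⟨h0, le_rfl⟩
  · split_ifs with h1 h2
    · exact ⟨h0, le_rfl⟩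
    · exact ⟨h0, le_rfl⟩
    · exact ⟨h1, not_lt.1 h2⟩

lemma winner_congr {l r : ℕ} (hl : l ≠ 0 → v (l - 1) = v' (l - 1))
    (hr : r ≠ 0 → v (r - 1) = v' (r - 1)) : winner v l r = winner v' l r := by
  unfold winner
  split_ifs <;> simp_all

lemma Above.child {j k : ℕ} (h : Above (2 * j) k ∨ Above (2 * j + 1) k) : Above j k := by
  rcases h with ⟨d, hd⟩ | ⟨d, hd⟩ <;>
  · refine ⟨d + 1, ?_⟩
    rw [pow_succ, ← Nat.div_div_eq_div_mul, ← hd]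
    omega

lemma above_half {j k : ℕ} (h : j = k / 2) : Above j k := ⟨0, by simpa using h⟩

lemma above_iff {j k : ℕ} : Above j k ↔ j = k / 2 ∨ Above j (k / 2) := by
  constructor
  · rintro ⟨d, hd⟩
    cases d with
    | zero => exact Or.inl (by simpa using hd)
    | succ d =>
      refine Or.inr ⟨d, ?_⟩
      rw [hd, Nat.div_div_eq_div_mul, ← pow_succ']
  · rintro (h | ⟨d, hd⟩)
    · exact above_half h
    · refine ⟨d + 1, ?_⟩
      rw [hd, Nat.div_div_eq_div_mul, ← pow_succ']

lemma IsTournamentExcept.isTournament (h : IsTournamentExcept n v T 1) : IsTournament n v T := by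
  intro j h1 h2
  refine h j h1 h2 ?_
  rintro ⟨d, hd⟩
  rw [Nat.div_eq_of_lt (Nat.one_lt_two_pow (by omega))] at hd
  omega

/-- Recomputing the parent repairs it and can disturb only nodes having it as a child, which are its
ancestors. -/
lemma IsTournamentExcept.up {k : ℕ} (h : IsTournamentExcept n v T k) :
    IsTournamentExcept n v (Function.update T (k / 2)
      (winner v (T (2 * (k / 2))) (T (2 * (k / 2) + 1)))) (k / 2) := by
  intro j h1 h2 h3
  have e1 : 2 * j ≠ k / 2 := fun he => h3 (above_half (by omega))
  have e2 : 2 * j + 1 ≠ k / 2 := fun he => h3 (above_half (by omega))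
  rw [Function.update_of_ne e1, Function.update_of_ne e2]
  by_cases hj : j = k / 2
  · rw [hj, Function.update_self]
  · rw [Function.update_of_ne hj]
    refine h j h1 h2 fun ha => ?_
    rw [above_iff] at ha
    tauto

/-- An inner node copies one of its children, so a cell can be traced down to a leaf containing it,
and only its own leaf may. Hence a cell occurs only on the path from its leaf to the root. -/
lemma IsTournament.above_of_eq (h : IsTournament n v T)
    (hleaf : ∀ i < n, T (n + i) = 0 ∨ T (n + i) = i + 1) {i k : ℕ} (h1 : 1 ≤ k) (h2 : k < 2 * n)
    (hk : T k = i + 1) : k = n + i ∨ Above k (n + i) := by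
  by_cases hkn : k < n
  · rcases winner_mem v (T (2 * k)) (T (2 * k + 1)) with hw | hw <;>
      rw [← h k h1 hkn, hk] at hw
    · rcases h.above_of_eq hleaf (k := 2 * k) (by omega) (by omega) hw.symm with h3 | h3
      · exact Or.inr (above_half (by omega))
      · exact Or.inr (.child (Or.inl h3))
    · rcases h.above_of_eq hleaf (k := 2 * k + 1) (by omega) (by omega) hw.symm with h3 | h3
      · exact Or.inr (above_half (by omega))
      · exact Or.inr (.child (Or.inr h3))
  · obtain ⟨i', rfl⟩ := Nat.exists_eq_add_of_le (not_lt.1 hkn)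
    rcases hleaf i' (by omega) with h3 | h3 <;> omega
termination_by 2 * n - k

/-- Changing the value and the leaf of one cell. -/
lemma IsTournament.update_leaf (h : IsTournament n v T)
    (hleaf : ∀ i < n, T (n + i) = 0 ∨ T (n + i) = i + 1) {i : ℕ} (hv : ∀ j, j ≠ i → v' j = v j)
    (c : ℕ) : IsTournamentExcept n v' (Function.update T (n + i) c) (n + i) := by
  intro j h1 h2 h3
  have e1 : 2 * j ≠ n + i := fun he => h3 (above_half (by omega))
  have e2 : 2 * j + 1 ≠ n + i := fun he => h3 (above_half (by omega))
  rw [Function.update_of_ne e1, Function.update_of_ne e2, Function.update_of_ne (by omega),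
    h j h1 h2]
  -- The comparison at `j` could change only if a child held the cell `i`; then `j` would lie above
  -- the leaf of `i`.
  refine winner_congr (fun h0 => (hv _ fun he => ?_).symm) (fun h0 => (hv _ fun he => ?_).symm)
  · rcases h.above_of_eq hleaf (k := 2 * j) (i := i) (by omega) (by omega) (by omega) with h4 | h4
    · exact e1 h4
    · exact h3 (.child (Or.inl h4))
  · rcases h.above_of_eq hleaf (k := 2 * j + 1) (i := i) (by omega) (by omega) (by omega) with
      h4 | h4
    · exact e2 h4
    · exact h3 (.child (Or.inr h4))

/-- Passing to the parent keeps a node nonempty and does not increase the value; induction runs up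
to the root. -/
lemma IsTournament.root_le (h : IsTournament n v T) {k : ℕ} (h1 : 1 ≤ k) (h2 : k < 2 * n)
    (hk : T k ≠ 0) : T 1 ≠ 0 ∧ v (T 1 - 1) ≤ v (T k - 1) := by
  by_cases hk1 : k = 1
  · subst hk1
    exact ⟨hk, le_rfl⟩
  · have hw := winner_spec v (l := T (2 * (k / 2))) (r := T (2 * (k / 2) + 1)) (c := T k) (by
      rcases Nat.even_or_odd' k with ⟨j, hj | hj⟩
      · left; congr 1; omega
      · right; congr 1; omega) hk
    rw [← h (k / 2) (by omega) (by omega)] at hw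
    obtain ⟨h3, h4⟩ := h.root_le (k := k / 2) (by omega) (by omega) hw.1
    exact ⟨h3, h4.trans hw.2⟩
termination_by k

lemma IsTournament.exists_leaf (h : IsTournament n v T) {k : ℕ} (h1 : 1 ≤ k) (h2 : k < 2 * n) :
    ∃ i < n, T (n + i) = T k := by
  by_cases hkn : k < n
  · rcases winner_mem v (T (2 * k)) (T (2 * k + 1)) with hw | hw <;>
      rw [h k h1 hkn, hw] <;> exact h.exists_leaf (by omega) (by omega)
  · exact ⟨k - n, by omega, by congr 1; omega⟩
termination_by 2 * n - k

end Tournament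

/-! ## Repairing the tournament -/

/-- One step towards the root: the integer register `11` contains a node, the integer array `12`
contains the tree, and the integer array `13` contains the doubles of the numbers below `n`. -/
def siftBody : Program :=
  .seq (.setNat 11 (.half (.reg 11))) <|
  .seq (.setNat 12 (.load 12 (.load 13 (.reg 11)))) <|
  .seq (.setNat 13 (.load 12 (.inc (.load 13 (.reg 11))))) <|
  .ite (.natEq (.reg 12) (.const 0)) (.storeNat 12 (.reg 11) (.reg 13)) <|
  .ite (.natEq (.reg 13) (.const 0)) (.storeNat 12 (.reg 11) (.reg 12)) <|
  .ite (.realLt (.load 2 (.dec (.reg 13))) (.load 2 (.dec (.reg 12))))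
    (.storeNat 12 (.reg 11) (.reg 13)) (.storeNat 12 (.reg 11) (.reg 12))

/-- The test whether the root is reached. -/
def siftTest : Test := .natLt (.const 1) (.reg 11)

/-- Repairing the tournament at the proper ancestors of the node in the integer register `11`. -/
def sift : Program := .while siftTest siftBody

/-- The time for repairing the tournament. -/
def siftTime (n : ℕ) : ℕ :=
  (Nat.log 2 n + 1) * (siftTest.time + siftBody.bound 0) + siftTest.time

/-- `m'` differs from `m` only in the registers `11`, `12`, `13` and in the inner nodes of the
tree, if at all. -/
structure SiftFrame (n : ℕ) (m m' : Memory) : Prop where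
  natReg : ∀ r < 11, m'.natReg r = m.natReg r
  realReg : m'.realReg = m.realReg
  natArr : ∀ a, a ≠ 12 → m'.natArr a = m.natArr a
  realArr : m'.realArr = m.realArr
  leaf : ∀ j, n ≤ j → m'.natArr 12 j = m.natArr 12 j

lemma siftBody_runs {n k : ℕ} {m₀ m : Memory} (hd : ∀ i < n, m₀.natArr 13 i = 2 * i)
    (hm : SiftFrame n m₀ m) (hk : m.natReg 11 = k) (hkn : k < 2 * n)
    (ht : IsTournamentExcept n (m.realArr 2) (m.natArr 12) k) :
    Runs 0 siftBody m fun m' => SiftFrame n m₀ m' ∧ m'.natReg 11 = k / 2 ∧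
      IsTournamentExcept n (m'.realArr 2) (m'.natArr 12) (k / 2) := by
  have hd' : m.natArr 13 (k / 2) = 2 * (k / 2) := by
    rw [hm.natArr 13 (by norm_num), hd _ (by omega)]
  -- All four branches write the winner into the parent, so they share this conclusion.
  have key : ∀ m' : Memory, (∀ r < 11, m'.natReg r = m.natReg r) → m'.natReg 11 = k / 2 →
      m'.realReg = m.realReg → (∀ a, a ≠ 12 → m'.natArr a = m.natArr a) →
      m'.realArr = m.realArr → m'.natArr 12 = Function.update (m.natArr 12) (k / 2)
        (winner (m.realArr 2) (m.natArr 12 (2 * (k / 2))) (m.natArr 12 (2 * (k / 2) + 1))) →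
      SiftFrame n m₀ m' ∧ m'.natReg 11 = k / 2 ∧
        IsTournamentExcept n (m'.realArr 2) (m'.natArr 12) (k / 2) := by
    intro m' h1 h2 h3 h4 h5 h6
    refine ⟨⟨fun r hr => (h1 r hr).trans (hm.natReg r hr), h3.trans hm.realReg,
      fun a ha => (h4 a ha).trans (hm.natArr a ha), h5.trans hm.realArr, fun j hj => ?_⟩, h2, ?_⟩
    · rw [h6, Function.update_of_ne (by omega), hm.leaf j hj]
    · rw [h5, h6]
      exact ht.up
  refine .seq (.setNat ?_)
  refine .seq (.setNat ?_)
  refine .seq (.setNat ?_)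
  refine .ite (fun h1 => .storeNat ?_) fun h1 => .ite (fun h2 => .storeNat ?_) fun h2 =>
    .ite (fun h3 => .storeNat ?_) fun h3 => .storeNat ?_
  all_goals
    refine key _ ?_ (by simp [NatExpr.eval, hk]) rfl ?_ rfl ?_
    · intro r hr
      simp [show r ≠ 11 by omega, show r ≠ 12 by omega, show r ≠ 13 by omega]
    · intro a ha
      simp [ha]
    · clear key
      simp [Test.Holds, NatExpr.eval, RealExpr.eval, hk, hd', -not_lt] at *
      simp [winner, *]

lemma sift_runs {n k : ℕ} {m : Memory} (hd : ∀ i < n, m.natArr 13 i = 2 * i)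
    (hk : m.natReg 11 = k) (hk0 : 1 ≤ k) (hkn : k < 2 * n)
    (ht : IsTournamentExcept n (m.realArr 2) (m.natArr 12) k) :
    Runs (siftTime n) sift m fun m' => SiftFrame n m m' ∧
      IsTournament n (m'.realArr 2) (m'.natArr 12) := by
  -- The level `L` of the current node is the number of halvings left.
  refine (Halts.while_count (T := siftBody.bound 0) (k := Nat.log 2 k)
    (I := fun L m' => SiftFrame n m m' ∧ 2 ^ L ≤ m'.natReg 11 ∧ m'.natReg 11 < 2 ^ (L + 1) ∧
      m'.natReg 11 < 2 * n ∧
      IsTournamentExcept n (m'.realArr 2) (m'.natArr 12) (m'.natReg 11)) ?_ ?_ ?_).mono ?_ ?_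
  · rintro m' ⟨-, -, h2, -⟩
    simp only [siftTest, Test.Holds, NatExpr.eval]
    omega
  · rintro L m' ⟨h1, h2, h3, h4, h5⟩
    have hL := Nat.one_le_two_pow (n := L)
    rw [pow_succ] at h2 h3
    refine ⟨?_, (siftBody_runs hd h1 rfl h4 h5).mono ?_⟩
    · simp only [siftTest, Test.Holds, NatExpr.eval]
      omega
    · rintro m'' ⟨i1, i2, i3⟩
      refine ⟨i1, ?_, ?_, ?_, i2 ▸ i3⟩ <;> rw [i2] <;> omega
  · refine ⟨⟨fun _ _ => rfl, rfl, fun _ _ => rfl, rfl, fun _ _ => rfl⟩, ?_, ?_, ?_, ?_⟩ <;> rw [hk]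
    · exact Nat.pow_log_le_self 2 (by omega)
    · exact Nat.lt_pow_succ_log_self (by norm_num) k
    · exact hkn
    · exact ht
  · simp only [sift, Program.bound, siftTime]
    gcongr
    -- The start node is below `2 * n`, whose logarithm is that of `n` plus one.
    rw [← Nat.log_mul_base (by norm_num) (by omega)]
    exact Nat.log_mono_right (by omega)
  · rintro m' ⟨h1, h2, h3, -, h5⟩
    have : m'.natReg 11 = 1 := by
      rw [pow_zero] at h2
      omega
    rw [this] at h5
    exact ⟨h1, h5.isTournament⟩

/-! ## Representing the state of the algorithm -/

section Representation

variable {n : ℕ} {G : LaneGraph (Fin n)} {P : Params} {goal : Fin n} {m m' : Memory}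
  {s : RouterState (Fin n)} {b : Fin n → Option (Fin n)} {x z c : Fin n} {w : ℕ}

/-- The memory `m` contains the input, the values and actions of `s`, the best successors `b`, and
two tables. -/
structure RepresentsCore (m : Memory) (G : LaneGraph (Fin n)) (P : Params) (goal : Fin n)
    (s : RouterState (Fin n)) (b : Fin n → Option (Fin n)) : Prop where
  input : StoresInput m G P goal
  output : StoresOutput m s.g s.act
  best : ∀ x : Fin n, m.natArr 11 x = cellCode (b x)
  double : ∀ i < n, m.natArr 13 i = 2 * i
  leafPos : ∀ i < n, m.natArr 14 i = n + i

/-- The leaves of the tree contain the cells in the queue. -/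
def StoresQueue (m : Memory) (q : Finset (Fin n)) : Prop :=
  ∀ x : Fin n, m.natArr 12 (n + x) = if x ∈ q then (x : ℕ) + 1 else 0

/-- The memory `m` contains the input, the state `s`, the best successors `b`, and two tables. -/
structure Represents (m : Memory) (G : LaneGraph (Fin n)) (P : Params) (goal : Fin n)
    (s : RouterState (Fin n)) (b : Fin n → Option (Fin n)) : Prop
    extends RepresentsCore m G P goal s b where
  queue : StoresQueue m s.queue
  tournament : IsTournament n (m.realArr 2) (m.natArr 12)

/-- The input arrays and the first `k` integer registers are the same in both memories. -/
structure Frame (k : ℕ) (m m' : Memory) : Prop where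
  natReg : ∀ r < k, m'.natReg r = m.natReg r
  natArr : ∀ a < 6, m'.natArr a = m.natArr a

lemma Frame.refl (k : ℕ) (m : Memory) : Frame k m m := ⟨fun _ _ => rfl, fun _ _ => rfl⟩

lemma Frame.trans {k k' : ℕ} {m'' : Memory} (h : Frame k m m') (h' : Frame k' m' m'')
    (hk : k' ≤ k) : Frame k' m m'' :=
  ⟨fun r hr => (h'.natReg r hr).trans (h.natReg r (hr.trans_le hk)),
    fun a ha => (h'.natArr a ha).trans (h.natArr a ha)⟩

lemma Frame.setNat {k r v : ℕ} (hr : k ≤ r) : Frame k m (m.setNat r v) :=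
  ⟨fun r' hr' => by simp [show r' ≠ r by omega], fun _ _ => rfl⟩

lemma Frame.setReal {k r : ℕ} {v : ℝ} : Frame k m (m.setReal r v) :=
  ⟨fun _ _ => rfl, fun _ _ => rfl⟩

lemma SiftFrame.frame (h : SiftFrame n m m') : Frame 11 m m' :=
  ⟨h.natReg, fun a ha => h.natArr a (by omega)⟩

lemma StoresInput.congr (h : StoresInput m G P goal) (h1 : ∀ r < 2, m'.natReg r = m.natReg r)
    (h2 : ∀ r < 3, m'.realReg r = m.realReg r) (h3 : ∀ a < 6, m'.natArr a = m.natArr a)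
    (h4 : ∀ a < 2, m'.realArr a = m.realArr a) : StoresInput m' G P goal := by
  refine ⟨?_, ?_, ?_, ?_, ?_, ?_, ?_, ?_, ?_, ?_, ?_⟩
  · rw [h1 0 (by norm_num), h.size]
  · rw [h1 1 (by norm_num), h.goal]
  · rw [h2 0 (by norm_num), h.rate]
  · rw [h2 1 (by norm_num), h.cLc]
  · rw [h2 2 (by norm_num), h.cFlc]
  · rw [h3 0 (by norm_num)]
    exact h.lnb
  · rw [h3 1 (by norm_num)]
    exact h.rnb
  · rw [h3 2 (by norm_num), h3 3 (by norm_num)]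
    exact h.pred
  · rw [h3 4 (by norm_num), h3 5 (by norm_num)]
    exact h.succ
  · rw [h4 0 (by norm_num)]
    exact h.length
  · rw [h4 1 (by norm_num)]
    exact h.cost

lemma StoresAction.congr {i : ℕ} {a : Option (Action (Fin n))} (h : StoresAction m i a)
    (h1 : ∀ k, 7 ≤ k → k < 11 → m'.natArr k i = m.natArr k i) : StoresAction m' i a := by
  have e7 := h1 7 (by norm_num) (by norm_num)
  have e8 := h1 8 (by norm_num) (by norm_num)
  have e9 := h1 9 (by norm_num) (by norm_num)
  have e10 := h1 10 (by norm_num) (by norm_num)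
  rcases a with _ | a | a | a <;> simp only [StoresAction, e7, e8, e9, e10] at h ⊢ <;> exact h

lemma StoresValue.congr {i : ℕ} {v : ℝ≥0∞} (h : StoresValue m i v)
    (h1 : m'.natArr 6 i = m.natArr 6 i) (h2 : m'.realArr 2 i = m.realArr 2 i) :
    StoresValue m' i v := by
  rw [StoresValue, h1, h2]
  exact h

lemma StoresValue.toReal {i : ℕ} {v : ℝ≥0∞} (h : StoresValue m i v) (hv : v ≠ ⊤) :
    m.realArr 2 i = v.toReal := by
  rcases h with ⟨-, h⟩ | ⟨-, -, h⟩
  · exact absurd h hv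
  · exact h

lemma RepresentsCore.congr (h : RepresentsCore m G P goal s b)
    (h1 : ∀ r < 2, m'.natReg r = m.natReg r) (h2 : ∀ r < 3, m'.realReg r = m.realReg r)
    (h3 : ∀ a, a ≠ 12 → m'.natArr a = m.natArr a) (h4 : m'.realArr = m.realArr) :
    RepresentsCore m' G P goal s b := by
  refine ⟨h.input.congr h1 h2 (fun a ha => h3 a (by omega)) (fun a _ => by rw [h4]),
    fun x => ⟨(h.output x).1.congr (by rw [h3 6 (by norm_num)]) (by rw [h4]),
      (h.output x).2.congr fun k _ hk => by rw [h3 k (by omega)]⟩, ?_, ?_, ?_⟩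
  · rw [h3 11 (by norm_num)]
    exact h.best
  · rw [h3 13 (by norm_num)]
    exact h.double
  · rw [h3 14 (by norm_num)]
    exact h.leafPos

lemma Represents.congr (h : Represents m G P goal s b)
    (h1 : ∀ r < 2, m'.natReg r = m.natReg r) (h2 : ∀ r < 3, m'.realReg r = m.realReg r)
    (h3 : m'.natArr = m.natArr) (h4 : m'.realArr = m.realArr) : Represents m' G P goal s b := by
  refine ⟨h.toRepresentsCore.congr h1 h2 (fun a _ => by rw [h3]) h4, ?_, ?_⟩
  · rw [StoresQueue, h3]
    exact h.queue
  · rw [h3, h4]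
    exact h.tournament

lemma Represents.setNat {r v : ℕ} (h : Represents m G P goal s b) (hr : 2 ≤ r) :
    Represents (m.setNat r v) G P goal s b :=
  h.congr (fun r' hr' => by simp [show r' ≠ r by omega]) (fun _ _ => rfl) rfl rfl

lemma Represents.setReal {r : ℕ} {v : ℝ} (h : Represents m G P goal s b) (hr : 3 ≤ r) :
    Represents (m.setReal r v) G P goal s b :=
  h.congr (fun _ _ => rfl) (fun r' hr' => by simp [show r' ≠ r by omega]) rfl rfl

/-- Repairing the tournament after a change of the leaf of `x`. -/
lemma RepresentsCore.sift_runs (h : RepresentsCore m G P goal s b) (hq : StoresQueue m s.queue)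
    (hx : m.natReg 11 = n + x)
    (ht : IsTournamentExcept n (m.realArr 2) (m.natArr 12) (n + x)) :
    Runs (siftTime n) sift m fun m' => Represents m' G P goal s b ∧ Frame 11 m m' := by
  have := x.isLt
  refine (LaneRouting.sift_runs h.double hx (by omega) (by omega) ht).mono ?_
  rintro m' ⟨h1, h2⟩
  refine ⟨⟨h.congr (fun r hr => h1.natReg r (by omega)) (fun r _ => by rw [h1.realReg]) h1.natArr
    h1.realArr, fun y => ?_, h2⟩, h1.frame⟩
  rw [h1.leaf _ (by omega)]
  exact hq y

lemma Represents.leaf_eq (h : Represents m G P goal s b) {i : ℕ} (hi : i < n) :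
    m.natArr 12 (n + i) = 0 ∨ m.natArr 12 (n + i) = i + 1 := by
  have := h.queue ⟨i, hi⟩
  dsimp only at this
  rw [this]
  split_ifs <;> simp

/-! ## Relaxing one action -/

/-- The cell in the integer register `6` gets the value in the real register `3`, and it is put
into the queue. -/
def enter : Program :=
  .seq (.storeNat 6 (.reg 6) (.const 1)) <|
  .seq (.storeReal 2 (.reg 6) (.reg 3)) <|
  .seq (.storeNat 12 (.load 14 (.reg 6)) (.inc (.reg 6))) <|
  .seq (.setNat 11 (.load 14 (.reg 6))) sift

/-- Insertion and decrease of a key are the same operation: value and leaf are overwritten, and only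
ancestors of the leaf need repair. -/
lemma enter_runs (h : Represents m G P goal s b) (hx : m.natReg 6 = x)
    (hq : 0 ≤ m.realReg 3) :
    Runs (siftTime n) enter m fun m' => Represents m' G P goal
      { g := Function.update s.g x (ENNReal.ofReal (m.realReg 3))
        act := s.act
        queue := insert x s.queue } b ∧ Frame 11 m m' := by
  refine .seq (.storeNat ?_)
  refine .seq (.storeReal ?_)
  refine .seq (.storeNat ?_)
  refine .seq (.setNat ?_)
  have hleaf := h.leafPos x x.isLt
  simp only [NatExpr.eval, RealExpr.eval, Memory.storeNat_natReg, Memory.storeReal_natReg,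
    Memory.storeNat_realReg, Memory.storeReal_natArr, Memory.storeNat_natArr, hx, hleaf,
    Nat.reduceEqDiff, if_false]
  refine (RepresentsCore.sift_runs (x := x) (G := G) (P := P) (goal := goal) (b := b)
    (s := { g := Function.update s.g x (ENNReal.ofReal (m.realReg 3))
            act := s.act
            queue := insert x s.queue }) ⟨?_, ?_, ?_, ?_, ?_⟩ ?_ (by simp) ?_).mono ?_
  · refine h.input.congr (fun r hr => ?_) (fun _ _ => rfl) (fun a ha => ?_) (fun a ha => ?_)
    · simp [show r ≠ 11 by omega]
    · simp [show a ≠ 12 by omega, show a ≠ 6 by omega]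
    · simp [show a ≠ 2 by omega]
  · intro y
    refine ⟨?_, (h.output y).2.congr fun k h1 h2 => ?_⟩
    · by_cases hy : y = x
      · subst hy
        right
        simp [hq]
      · have hyx : (y : ℕ) ≠ x := fun e => hy (Fin.ext e)
        simp only [Function.update_of_ne hy]
        exact (h.output y).1.congr (by simp [hyx]) (by simp [hyx])
    · simp [show k ≠ 6 by omega, show k ≠ 12 by omega]
  · simpa using h.best
  · simpa using h.double
  · simpa using h.leafPos
  · intro y
    by_cases hy : y = x
    · subst hy
      simp
    · have hyx : (y : ℕ) ≠ x := fun e => hy (Fin.ext e)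
      simpa [hyx, hy] using h.queue y
  · have := h.tournament.update_leaf (fun i hi => h.leaf_eq hi) (i := x)
      (v' := Function.update (m.realArr 2) x (m.realReg 3))
      (fun j hj => Function.update_of_ne hj _ _) (x + 1)
    simpa using this
  · rintro m' ⟨h1, h2⟩
    refine ⟨h1, ?_⟩
    refine Frame.trans (k := 11) ⟨fun r hr => ?_, fun a ha => ?_⟩ h2 le_rfl
    · simp [show r ≠ 11 by omega]
    · simp [show a ≠ 12 by omega, show a ≠ 6 by omega]

/-- The integer registers `7` to `10` contain the action `a`. -/
def StagesAction (m : Memory) : Action (Fin n) → Prop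
  | .stay y => m.natReg 7 = 1 ∧ m.natReg 9 = y
  | .change k y t => m.natReg 7 = 2 ∧ m.natReg 8 = k ∧ m.natReg 9 = y ∧ m.natReg 10 = t
  | .forced k t => m.natReg 7 = 3 ∧ m.natReg 8 = k ∧ m.natReg 10 = t

/-- The action in the integer registers `7` to `10` becomes the action of the cell in the integer
register `6`. -/
def storeAction : Program :=
  .seq (.storeNat 7 (.reg 6) (.reg 7)) <|
  .seq (.storeNat 8 (.reg 6) (.reg 8)) <|
  .seq (.storeNat 9 (.reg 6) (.reg 9)) (.storeNat 10 (.reg 6) (.reg 10))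

lemma storeAction_runs (h : Represents m G P goal s b) (hx : m.natReg 6 = x)
    {a : Action (Fin n)} (ha : StagesAction m a) :
    Runs w storeAction m fun m' => Represents m' G P goal
      { s with act := Function.update s.act x (some a) } b ∧ Frame 11 m m' := by
  refine .seq (.storeNat ?_)
  refine .seq (.storeNat ?_)
  refine .seq (.storeNat (.storeNat ?_))
  simp only [NatExpr.eval, Memory.storeNat_natReg, hx]
  refine ⟨⟨⟨?_, ?_, ?_, ?_, ?_⟩, ?_, ?_⟩, fun _ _ => rfl, fun a ha => ?_⟩
  · refine h.input.congr (fun _ _ => rfl) (fun _ _ => rfl) (fun a ha => ?_) (fun _ _ => rfl)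
    simp [show a ≠ 7 by omega, show a ≠ 8 by omega, show a ≠ 9 by omega, show a ≠ 10 by omega]
  · intro y
    refine ⟨(h.output y).1.congr (by simp) (by simp), ?_⟩
    by_cases hy : y = x
    · subst hy
      rcases a <;> simpa [StoresAction, StagesAction] using ha
    · have hyx : (y : ℕ) ≠ x := fun e => hy (Fin.ext e)
      simp only [Function.update_of_ne hy]
      refine (h.output y).2.congr fun k _ _ => ?_
      simp only [Memory.storeNat_natArr]
      split_ifs <;> simp_all
  · simpa using h.best
  · simpa using h.double
  · simpa using h.leafPos
  · simpa [StoresQueue] using h.queue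
  · simpa using h.tournament
  · simp [show a ≠ 7 by omega, show a ≠ 8 by omega, show a ≠ 9 by omega, show a ≠ 10 by omega]

/-- The test whether the real register `3` contains no improvement for the cell in the integer
register `6`. -/
def noImprovement : Test :=
  .and (.natEq (.load 6 (.reg 6)) (.const 1)) (.neg (.realLt (.reg 3) (.load 2 (.reg 6))))

/-- Relaxing the action in the integer registers `7` to `10` for the cell in the integer register
`6`; the real register `3` contains the value of the action. -/
def relaxProgram : Program :=
  .ite noImprovement .skip (.seq enter storeAction)

/-- The flag is tested as well, because the stored real number is arbitrary while the value is
infinite. -/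
lemma noImprovement_holds (h : StoresOutput m s.g s.act) (hx : m.natReg 6 = x)
    (hq : 0 ≤ m.realReg 3) :
    noImprovement.Holds m ↔ ¬ ENNReal.ofReal (m.realReg 3) < s.g x := by
  simp only [noImprovement, Test.Holds, NatExpr.eval, RealExpr.eval, hx]
  rcases (h x).1 with ⟨h1, h2⟩ | ⟨h1, h2, h3⟩
  · simp [h1, h2]
  · rw [h1, h3, ENNReal.ofReal_lt_iff_lt_toReal hq h2]
    simp

lemma relaxProgram_runs (h : Represents m G P goal s b) (hx : m.natReg 6 = x)
    {a : Action (Fin n)} (ha : StagesAction m a) (hq : 0 ≤ m.realReg 3)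
    (hv : qValue G P s.g x a = ENNReal.ofReal (m.realReg 3)) :
    Runs (siftTime n) relaxProgram m fun m' => Represents m' G P goal (relax G P s (x, a)) b ∧
      Frame 6 m m' := by
  refine .ite (fun hn => .skip ?_) fun hn => ?_
  · rw [noImprovement_holds h.output hx hq] at hn
    rw [relax, if_neg (by simpa only [hv] using hn)]
    exact ⟨h, .refl 6 m⟩
  · rw [noImprovement_holds h.output hx hq, not_not] at hn
    rw [relax, if_pos (by simpa only [hv] using hn)]
    refine .seq ((enter_runs h hx hq).mono ?_)
    rintro m' ⟨h1, h2⟩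
    refine (storeAction_runs h1 ((h2.natReg 6 (by norm_num)).trans hx) (a := a) ?_).mono ?_
    · rcases a <;> simpa [StagesAction, h2.natReg] using ha
    · rintro m'' ⟨h3, h4⟩
      refine ⟨?_, h2.trans (h4.trans (.refl 6 _) (by norm_num)) (by norm_num)⟩
      simpa only [hv] using h3

/-- The success probability of a lane change in the cell in the integer register `6`. -/
def successExpr : RealExpr :=
  .sub (.const 1) (.exp (.sub (.const 0) (.mul (.reg 0) (.load 0 (.reg 6)))))

lemma successExpr_eval (h : StoresInput m G P goal) (hx : m.natReg 6 = x) :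
    successExpr.eval m = P.success (G.length x) := by
  simp [successExpr, RealExpr.eval, NatExpr.eval, hx, h.rate, h.length, Params.success]

/-- Relaxing the action of staying in lane, in the cell in the integer register `6`; the register
`9` contains the successor. -/
def tryStay : Program :=
  .seq (.setNat 7 (.const 1)) <|
  .seq (.setReal 3 (.add (.load 1 (.reg 6)) (.load 2 (.reg 9)))) relaxProgram

lemma tryStay_runs (h : Represents m G P goal s b) {y : Fin n} (hx : m.natReg 6 = x)
    (hy : m.natReg 9 = y) (hgy : s.g y ≠ ⊤) :
    Runs (siftTime n) tryStay m fun m' => Represents m' G P goal (relax G P s (x, .stay y)) b ∧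
      Frame 6 m m' := by
  refine .seq (.setNat (.seq (.setReal ?_)))
  have hval : (G.cost x + (s.g y).toReal) =
      RealExpr.eval (m.setNat 7 1) (.add (.load 1 (.reg 6)) (.load 2 (.reg 9))) := by
    simp [RealExpr.eval, NatExpr.eval, hx, hy, h.input.cost, (h.output y).1.toReal hgy]
  refine (relaxProgram_runs (((h.setNat (by norm_num)).setReal (by norm_num))) (x := x)
    (a := .stay y) ?_ ?_ ?_ ?_).mono ?_
  · simpa using hx
  · simpa [StagesAction, NatExpr.eval] using hy
  · simp only [NatExpr.eval, Memory.setReal_realReg, if_true, ← hval]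
    have := G.cost_pos x
    positivity
  · simp only [NatExpr.eval, Memory.setReal_realReg, if_true, ← hval]
    exact qValue_stay_eq_ofReal G P s.g x hgy
  · rintro m' ⟨h1, h2⟩
    exact ⟨h1, ((Frame.setNat (by norm_num)).trans .setReal le_rfl).trans h2 le_rfl⟩

/-- Relaxing a lane change in the cell in the integer register `6`; the registers `8`, `9` and `10`
contain the neighbor and the cells to move to in the case of failure and of success. -/
def tryChange : Program :=
  .seq (.setNat 7 (.const 2)) <|
  .seq (.setReal 3 (.add
    (.mul successExpr (.add (.add (.reg 1) (.load 1 (.reg 6))) (.load 2 (.reg 10))))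
    (.mul (.sub (.const 1) successExpr) (.add (.load 1 (.reg 6)) (.load 2 (.reg 9))))))
  relaxProgram

lemma tryChange_runs (h : Represents m G P goal s b) {k y t : Fin n} (hx : m.natReg 6 = x)
    (hk : m.natReg 8 = k) (hy : m.natReg 9 = y) (ht : m.natReg 10 = t) (hgy : s.g y ≠ ⊤)
    (hgt : s.g t ≠ ⊤) :
    Runs (siftTime n) tryChange m fun m' =>
      Represents m' G P goal (relax G P s (x, .change k y t)) b ∧ Frame 6 m m' := by
  refine .seq (.setNat (.seq (.setReal ?_)))
  have h7 : Represents (m.setNat 7 2) G P goal s b := h.setNat (by norm_num)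
  have hval : P.success (G.length x) * (P.cLc + G.cost x + (s.g t).toReal) +
        (1 - P.success (G.length x)) * (G.cost x + (s.g y).toReal) =
      RealExpr.eval (m.setNat 7 2) (.add
        (.mul successExpr (.add (.add (.reg 1) (.load 1 (.reg 6))) (.load 2 (.reg 10))))
        (.mul (.sub (.const 1) successExpr) (.add (.load 1 (.reg 6)) (.load 2 (.reg 9))))) := by
    simp [RealExpr.eval, NatExpr.eval, hx, hy, ht, h.input.cost, (h.output y).1.toReal hgy,
      (h.output t).1.toReal hgt, h.input.cLc,
      successExpr_eval h7.input (x := x) (by simpa using hx)]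
  refine (relaxProgram_runs (h7.setReal (by norm_num)) (x := x)
    (a := .change k y t) ?_ ?_ ?_ ?_).mono ?_
  · simpa using hx
  · simpa [StagesAction] using ⟨hk, hy, ht⟩
  · simp only [NatExpr.eval, Memory.setReal_realReg, if_true, ← hval]
    have h1 := G.cost_pos x
    have h2 := P.success_pos (G.length_pos x)
    have h3 := sub_pos.2 (P.success_lt_one (G.length x))
    have h4 := P.cLc_nonneg
    positivity
  · simp only [NatExpr.eval, Memory.setReal_realReg, if_true, ← hval]
    exact qValue_change_eq_ofReal G P s.g x k hgy hgt
  · rintro m' ⟨h1, h2⟩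
    exact ⟨h1, ((Frame.setNat (by norm_num)).trans .setReal le_rfl).trans h2 le_rfl⟩

/-- Relaxing a forced lane change in the cell in the integer register `6`; the registers `8` and
`10` contain the neighbor and the cell to move to. -/
def tryForced : Program :=
  .seq (.setNat 7 (.const 3)) <|
  .seq (.setReal 3 (.add (.add (.add (.reg 1) (.load 1 (.reg 6)))
    (.mul (.sub (.const 1) successExpr) (.reg 2))) (.load 2 (.reg 10))))
  relaxProgram

lemma tryForced_runs (h : Represents m G P goal s b) {k t : Fin n} (hx : m.natReg 6 = x)
    (hk : m.natReg 8 = k) (ht : m.natReg 10 = t) (hgt : s.g t ≠ ⊤) :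
    Runs (siftTime n) tryForced m fun m' =>
      Represents m' G P goal (relax G P s (x, .forced k t)) b ∧ Frame 6 m m' := by
  refine .seq (.setNat (.seq (.setReal ?_)))
  have h7 : Represents (m.setNat 7 3) G P goal s b := h.setNat (by norm_num)
  have hval : P.cLc + G.cost x + (1 - P.success (G.length x)) * P.cFlc + (s.g t).toReal =
      RealExpr.eval (m.setNat 7 3) (.add (.add (.add (.reg 1) (.load 1 (.reg 6)))
        (.mul (.sub (.const 1) successExpr) (.reg 2))) (.load 2 (.reg 10))) := by
    simp [RealExpr.eval, NatExpr.eval, hx, ht, h.input.cost,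
      (h.output t).1.toReal hgt, h.input.cLc, h.input.cFlc,
      successExpr_eval h7.input (x := x) (by simpa using hx)]
  refine (relaxProgram_runs (h7.setReal (by norm_num)) (x := x)
    (a := .forced k t) ?_ ?_ ?_ ?_).mono ?_
  · simpa using hx
  · simpa [StagesAction] using ⟨hk, ht⟩
  · simp only [NatExpr.eval, Memory.setReal_realReg, if_true, ← hval]
    have h1 := G.cost_pos x
    have h3 := sub_pos.2 (P.success_lt_one (G.length x))
    have h4 := P.cLc_nonneg
    have h5 := P.cFlc_nonneg
    positivity
  · simp only [NatExpr.eval, Memory.setReal_realReg, if_true, ← hval]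
    exact qValue_forced_eq_ofReal G P s.g x k hgt
  · rintro m' ⟨h1, h2⟩
    exact ⟨h1, ((Frame.setNat (by norm_num)).trans .setReal le_rfl).trans h2 le_rfl⟩

/-! ## Processing one predecessor -/

/-- Relaxing the lane changes between the cell in the integer register `4` and its neighbor whose
code is in the register `5`; the register `2` contains the best successor of the former. -/
def tryNeighbor : Program :=
  .ite (.natEq (.reg 5) (.const 0)) .skip <|
  .seq (.setNat 5 (.dec (.reg 5))) <|
  .seq (.setNat 6 (.reg 5)) <|
  .seq (.setNat 8 (.reg 4)) <|
  .seq (.setNat 10 (.reg 2)) <|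
  .seq tryForced <|
  .ite (.natEq (.load 11 (.reg 5)) (.const 0)) .skip <|
  .seq (.setNat 6 (.reg 5)) <|
  .seq (.setNat 8 (.reg 4)) <|
  .seq (.setNat 9 (.dec (.load 11 (.reg 5)))) <|
  .seq (.setNat 10 (.reg 2)) <|
  .seq tryChange <|
  .seq (.setNat 6 (.reg 4)) <|
  .seq (.setNat 8 (.reg 5)) <|
  .seq (.setNat 9 (.reg 2)) <|
  .seq (.setNat 10 (.dec (.load 11 (.reg 5)))) tryChange

lemma relax_g_ne_top {c : Fin n × Action (Fin n)} (h : s.g x ≠ ⊤) : (relax G P s c).g x ≠ ⊤ :=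
  ne_top_of_le_ne_top h (relax_g_le c x)

lemma tryNeighbor_runs (h : Represents m G P goal s b) {o : Option (Fin n)}
    (hz : m.natReg 2 = z) (hc : m.natReg 4 = c) (ho : m.natReg 5 = cellCode o)
    (hgz : s.g z ≠ ⊤) (hb : ∀ y t, b y = some t → s.g t ≠ ⊤) :
    Runs (siftTime n) tryNeighbor m fun m' =>
      Represents m' G P goal ((neighborPairs z c b o).foldl (relax G P) s) b ∧ Frame 5 m m' := by
  refine .ite (fun h0 => .skip ?_) fun h0 => ?_
  · cases o with
    | none => exact ⟨h, .refl 5 m⟩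
    | some y => simp [Test.Holds, NatExpr.eval, ho, cellCode] at h0
  cases o with
  | none => simp [Test.Holds, NatExpr.eval, ho, cellCode] at h0
  | some y =>
  refine .seq (.setNat (.seq (.setNat (.seq (.setNat (.seq (.setNat (.seq ?_))))))))
  simp only [NatExpr.eval, Memory.setNat_natReg, ho, hc, hz, cellCode, Nat.reduceEqDiff, if_true,
    if_false, Nat.add_sub_cancel]
  refine (tryForced_runs (x := y) (k := c) (t := z) (((((h.setNat (r := 5) (by norm_num)).setNat
    (r := 6) (by norm_num)).setNat (r := 8) (by norm_num)).setNat (r := 10) (by norm_num)))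
    (by simp) (by simp) (by simp) hgz).mono ?_
  rintro m₁ ⟨h1, f1⟩
  have hz1 : m₁.natReg 2 = z := by simpa [hz] using f1.natReg 2 (by norm_num)
  have hc1 : m₁.natReg 4 = c := by simpa [hc] using f1.natReg 4 (by norm_num)
  have hy1 : m₁.natReg 5 = y := by simpa using f1.natReg 5 (by norm_num)
  have hb1 := h1.best y
  have f1' : Frame 5 m m₁ := by
    refine Frame.trans (k := 5) ⟨fun r hr => ?_, fun _ _ => ?_⟩ (f1.trans (.refl 5 _)
      (by norm_num)) le_rfl
    · simp [show r ≠ 5 by omega, show r ≠ 6 by omega, show r ≠ 8 by omega, show r ≠ 10 by omega]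
    · rfl
  simp only [neighborPairs, List.foldl_cons]
  refine .ite (fun h0 => .skip ?_) fun h0 => ?_
  · cases hby : b y with
    | none => exact ⟨h1, f1'⟩
    | some t => simp [Test.Holds, NatExpr.eval, hy1, hb1, hby, cellCode] at h0
  cases hby : b y with
  | none => simp [Test.Holds, NatExpr.eval, hy1, hb1, hby, cellCode] at h0
  | some t =>
  rw [hby, cellCode] at hb1
  refine .seq (.setNat (.seq (.setNat (.seq (.setNat (.seq (.setNat (.seq ?_))))))))
  simp only [NatExpr.eval, Memory.setNat_natReg, Memory.setNat_natArr, hy1, hc1, hz1, hb1,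
    Nat.reduceEqDiff, if_false, Nat.add_sub_cancel]
  refine (tryChange_runs (x := y) (k := c) (y := t) (t := z) (((((h1.setNat (r := 6)
    (by norm_num)).setNat (r := 8) (by norm_num)).setNat (r := 9) (by norm_num)).setNat (r := 10)
    (by norm_num))) (by simp) (by simp) (by simp) (by simp) (relax_g_ne_top (hb y t hby))
    (relax_g_ne_top hgz)).mono ?_
  rintro m₂ ⟨h2, f2⟩
  have hz2 : m₂.natReg 2 = z := by simpa [hz1] using f2.natReg 2 (by norm_num)
  have hc2 : m₂.natReg 4 = c := by simpa [hc1] using f2.natReg 4 (by norm_num)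
  have hy2 : m₂.natReg 5 = y := by simpa [hy1] using f2.natReg 5 (by norm_num)
  have hb2 := h2.best y
  rw [hby, cellCode] at hb2
  have f2' : Frame 5 m₁ m₂ := by
    refine Frame.trans (k := 5) ⟨fun r hr => ?_, fun _ _ => ?_⟩ (f2.trans (.refl 5 _)
      (by norm_num)) le_rfl
    · simp [show r ≠ 9 by omega, show r ≠ 6 by omega, show r ≠ 8 by omega, show r ≠ 10 by omega]
    · rfl
  refine .seq (.setNat (.seq (.setNat (.seq (.setNat (.seq (.setNat ?_)))))))
  simp only [NatExpr.eval, Memory.setNat_natReg, Memory.setNat_natArr, hy2, hc2, hz2, hb2,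
    Nat.reduceEqDiff, if_false, Nat.add_sub_cancel]
  refine (tryChange_runs (x := c) (k := y) (y := z) (t := t) (((((h2.setNat (r := 6)
    (by norm_num)).setNat (r := 8) (by norm_num)).setNat (r := 9) (by norm_num)).setNat (r := 10)
    (by norm_num))) (by simp) (by simp) (by simp) (by simp)
    (relax_g_ne_top (relax_g_ne_top hgz))
    (relax_g_ne_top (relax_g_ne_top (hb y t hby)))).mono ?_
  rintro m₃ ⟨h3, f3⟩
  refine ⟨h3, (f1'.trans f2' le_rfl).trans (Frame.trans (k := 5) ⟨fun r hr => ?_, fun _ _ => ?_⟩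
    (f3.trans (.refl 5 _) (by norm_num)) le_rfl) le_rfl⟩
  · simp [show r ≠ 9 by omega, show r ≠ 6 by omega, show r ≠ 8 by omega, show r ≠ 10 by omega]
  · rfl

/-- If the cell in the integer register `4` has no best successor yet, then the cell in the
register `2` becomes its best successor. -/
def processCell : Program :=
  .ite (.natEq (.load 11 (.reg 4)) (.const 0))
    (.seq (.storeNat 11 (.reg 4) (.inc (.reg 2))) <|
      .seq (.setNat 6 (.reg 4)) <|
      .seq (.setNat 9 (.reg 2)) <|
      .seq tryStay <|
      .seq (.setNat 5 (.load 0 (.reg 4))) <|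
      .seq tryNeighbor <|
      .seq (.setNat 5 (.load 1 (.reg 4))) tryNeighbor)
    .skip

lemma Represents.storeBest (h : Represents m G P goal s b) (x y : Fin n) :
    Represents (m.storeNat 11 x (y + 1)) G P goal s (Function.update b x (some y)) := by
  refine ⟨⟨?_, fun i => ⟨(h.output i).1.congr (by simp) (by simp), (h.output i).2.congr
    fun k h1 h2 => by simp [show k ≠ 11 by omega]⟩, fun i => ?_, ?_, ?_⟩, ?_, ?_⟩
  · refine h.input.congr (fun _ _ => rfl) (fun _ _ => rfl) (fun a ha => ?_) (fun _ _ => rfl)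
    simp [show a ≠ 11 by omega]
  · by_cases hi : i = x
    · subst hi
      simp [cellCode]
    · have hix : (i : ℕ) ≠ x := fun e => hi (Fin.ext e)
      simpa [hi, hix] using h.best i
  · simpa using h.double
  · simpa using h.leafPos
  · simpa [StoresQueue] using h.queue
  · simpa using h.tournament

lemma processCell_runs (h : Represents m G P goal s b) (hz : m.natReg 2 = z)
    (hc : m.natReg 4 = c) (hgz : s.g z ≠ ⊤) (hb : ∀ y t, b y = some t → s.g t ≠ ⊤) :
    Runs (siftTime n) processCell m fun m' =>
      Represents m' G P goal (cellStep G P z (s, b) c).1 (cellStep G P z (s, b) c).2 ∧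
        Frame 4 m m' := by
  have hbc := h.best c
  unfold cellStep
  refine .ite (fun h0 => ?_) fun h0 => .skip ?_
  swap
  · have : b c ≠ none := by
      intro hn
      simp [Test.Holds, NatExpr.eval, hc, hbc, hn, cellCode] at h0
    simp only [this, if_false]
    exact ⟨h, .refl 4 m⟩
  have hbn : b c = none := by
    cases hn : b c with
    | none => rfl
    | some y => simp [Test.Holds, NatExpr.eval, hc, hbc, hn, cellCode] at h0
  simp only [hbn, if_true]
  set b' := Function.update b c (some z) with hb'
  have hb'g : ∀ y t, b' y = some t → s.g t ≠ ⊤ := by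
    intro y t hyt
    by_cases hy : y = c
    · subst hy
      rw [hb', Function.update_self, Option.some.injEq] at hyt
      exact hyt ▸ hgz
    · rw [hb', Function.update_of_ne hy] at hyt
      exact hb y t hyt
  -- Finite values stay finite under relaxation, so the stored reals remain meaningful for the
  -- second neighbor.
  have hfold : ∀ (l : List (Fin n × Action (Fin n))) (s : RouterState (Fin n)) (y : Fin n),
      s.g y ≠ ⊤ → (l.foldl (relax G P) s).g y ≠ ⊤ := by
    intro l
    induction l with
    | nil => exact fun _ _ h => h
    | cons c l ih => exact fun s y h => ih _ y (relax_g_ne_top h)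
  refine .seq (.storeNat (.seq (.setNat (.seq (.setNat (.seq ?_))))))
  simp only [NatExpr.eval, Memory.setNat_natReg, Memory.storeNat_natReg, hc, hz,
    Nat.reduceEqDiff, if_false]
  refine (tryStay_runs (x := c) (y := z) (((h.storeBest c z).setNat (r := 6) (by norm_num)).setNat
    (r := 9) (by norm_num)) (by simp) (by simp) hgz).mono ?_
  rintro m₁ ⟨h1, f1⟩
  have hz1 : m₁.natReg 2 = z := by simpa [hz] using f1.natReg 2 (by norm_num)
  have hc1 : m₁.natReg 4 = c := by simpa [hc] using f1.natReg 4 (by norm_num)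
  have f1' : Frame 5 m m₁ := by
    refine Frame.trans (k := 5) ⟨fun r hr => ?_, fun a ha => ?_⟩ (f1.trans (.refl 5 _)
      (by norm_num)) le_rfl
    · simp [show r ≠ 9 by omega, show r ≠ 6 by omega]
    · simp [show a ≠ 11 by omega]
  refine .seq (.setNat (.seq ?_))
  refine (tryNeighbor_runs (o := G.lnb c) (h1.setNat (r := 5) (by norm_num))
    (by simpa using hz1) (by simpa using hc1) ?_ (relax_g_ne_top hgz)
    fun y t hyt => relax_g_ne_top (hb'g y t hyt)).mono ?_
  · simpa [NatExpr.eval, hc1] using h1.input.lnb c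
  rintro m₂ ⟨h2, f2⟩
  have f2' : Frame 5 m₁ m₂ := (Frame.setNat le_rfl).trans f2 le_rfl
  have hz2 : m₂.natReg 2 = z := by simpa [hz1] using f2'.natReg 2 (by norm_num)
  have hc2 : m₂.natReg 4 = c := by simpa [hc1] using f2'.natReg 4 (by norm_num)
  refine .seq (.setNat ?_)
  refine (tryNeighbor_runs (o := G.rnb c) (h2.setNat (r := 5) (by norm_num))
    (by simpa using hz2) (by simpa using hc2) ?_ (hfold _ _ _ (relax_g_ne_top hgz))
    fun y t hyt => hfold _ _ _ (relax_g_ne_top (hb'g y t hyt))).mono ?_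
  · simpa [NatExpr.eval, hc2] using h2.input.rnb c
  rintro m₃ ⟨h3, f3⟩
  refine ⟨?_, (f1'.trans (f2'.trans ((Frame.setNat le_rfl).trans f3 le_rfl) le_rfl) le_rfl).trans
    (.refl 4 _) (by norm_num)⟩
  simpa only [cellPairs, List.foldl_cons, List.foldl_append] using h3

end Representation

/-! ## The main loop -/

section MainLoop

variable {n : ℕ} {G : LaneGraph (Fin n)} {P : Params} {goal : Fin n} {m m' : Memory}
  {s : RouterState (Fin n)} {b : Fin n → Option (Fin n)} {D : Finset (Fin n)} {z : Fin n}

/-- The test whether the list of predecessors of the cell in the integer register `2` goes on. -/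
def scanTest : Test := .natLt (.reg 3) (.load 2 (.inc (.reg 2)))

/-- Processing the predecessor at the position in the integer register `3`. -/
def scanBody : Program :=
  .seq (.setNat 4 (.load 3 (.reg 3))) <| .seq processCell (.setNat 3 (.inc (.reg 3)))

lemma StoresLists.card {off arr : ℕ → ℕ} {S : Fin n → Finset (Fin n)}
    (h : StoresLists off arr S) (x : Fin n) : off x + (S x).card = off (x + 1) := by
  obtain ⟨h1, h2⟩ := h.2 x
  have h3 := h2.injOn.ncard_image
  rw [h2.image_eq, Set.ncard_image_of_injective _ Fin.val_injective, Set.ncard_coe_finset,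
    Set.ncard_eq_toFinset_card', Set.toFinset_Ico, Nat.card_Ico] at h3
  omega

lemma scan_halts (hG : ∀ x, P.rate * P.cFlc ≤ G.cost x / G.length x)
    (h : Represents m G P goal s b) (hI : ScanInv G P goal D z ∅ s b) (hz : m.natReg 2 = z)
    (he : m.natReg 3 = m.natArr 2 z) :
    Halts (.while scanTest scanBody) m
      ((G.pred z).card * (scanTest.time + scanBody.bound (siftTime n)) + scanTest.time)
      fun m' => ∃ s' b', Represents m' G P goal s' b' ∧ MainInv G P goal (insert z D) s' b' := by
  have hcard := h.input.pred.card z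
  obtain ⟨-, hbij⟩ := h.input.pred.2 z
  -- The scanned set consists of the predecessors at positions before the counter; `k` is the number
  -- of positions left.
  refine (Halts.while_count (I := fun k m' => m'.natReg 2 = z ∧
    (∀ a < 6, m'.natArr a = m.natArr a) ∧ m.natArr 2 z ≤ m'.natReg 3 ∧
    m'.natReg 3 + k = m.natArr 2 (z + 1) ∧ ∃ s' b', Represents m' G P goal s' b' ∧
      ScanInv G P goal D z {c | ∃ e, m.natArr 2 z ≤ e ∧ e < m'.natReg 3 ∧ m.natArr 3 e = c} s' b')
    ?_ ?_ ?_).mono le_rfl ?_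
  · rintro m' ⟨h1, h2, h3, h4, -⟩
    simp only [scanTest, Test.Holds, NatExpr.eval, h1, h2 2 (by norm_num)]
    omega
  · rintro k m' ⟨h1, h2, h3, h4, s', b', h5, h6⟩
    refine ⟨?_, ?_⟩
    · simp only [scanTest, Test.Holds, NatExpr.eval, h1, h2 2 (by norm_num)]
      omega
    obtain ⟨c, hc, hce⟩ := hbij.mapsTo (show m'.natReg 3 ∈ Set.Ico _ _ from ⟨h3, by omega⟩)
    have hne : ∀ y ∈ insert z D, s'.g y ≠ ⊤ := fun y hy => (h6.router.ne_top_iff y).2 (Or.inl hy)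
    refine Runs.seq (.setNat (.seq ?_))
    refine (processCell_runs (z := z) (c := c) (h5.setNat (r := 4) (by norm_num))
      (by simpa using h1) ?_ (hne z (by simp)) fun y t hyt => hne t (h6.best.mem y t hyt).1).mono ?_
    · simp [NatExpr.eval, h2 3 (by norm_num), ← hce]
    rintro m'' ⟨h7, f7⟩
    have e2 : m''.natReg 2 = z := by simpa [h1] using f7.natReg 2 (by norm_num)
    have e3 : m''.natReg 3 = m'.natReg 3 := by simpa using f7.natReg 3 (by norm_num)
    refine .setNat ⟨by simpa using e2, fun a ha => (f7.natArr a ha).trans (h2 a ha),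
      by simp [NatExpr.eval, e3]; omega, by simp [NatExpr.eval, e3]; omega, _, _,
      h7.setNat (by norm_num), ?_⟩
    refine { h6.cellStep hG (m := c) (by simpa using hc) with scanned := ?_ }
    rintro y ⟨e, he1, he2, he3⟩
    refine (h6.cellStep hG (m := c) (by simpa using hc)).scanned y ?_
    simp only [NatExpr.eval, Memory.setNat_natReg, if_true, e3] at he2
    by_cases hee : e = m'.natReg 3
    · left
      rw [hee, ← hce] at he3
      exact Fin.ext he3.symm
    · exact Or.inr ⟨e, he1, by omega, he3⟩
  · refine ⟨hz, fun _ _ => rfl, he.ge, by omega, s, b, h, ?_⟩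
    refine { hI with scanned := ?_ }
    rintro y ⟨e, he1, he2, -⟩
    omega
  · rintro m' ⟨-, -, -, h4, s', b', h5, h6⟩
    refine ⟨s', b', h5, h6.mainInv fun c hc => ?_⟩
    obtain ⟨e, ⟨he1, he2⟩, he3⟩ := hbij.surjOn ⟨c, hc, rfl⟩
    exact ⟨e, he1, by omega, he3⟩

/-- Removing the cell at the root of the tournament. -/
def removeRoot : Program :=
  .seq (.setNat 2 (.dec (.load 12 (.const 1)))) <|
  .seq (.storeNat 12 (.load 14 (.reg 2)) (.const 0)) <|
  .seq (.setNat 11 (.load 14 (.reg 2))) <|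
  .seq sift (.setNat 3 (.load 2 (.reg 2)))

lemma removeRoot_runs (h : Represents m G P goal s b) (hz : m.natArr 12 1 = z + 1) :
    Runs (siftTime n) removeRoot m fun m' =>
      Represents m' G P goal { s with queue := s.queue.erase z } b ∧ m'.natReg 2 = z ∧
        m'.natReg 3 = m'.natArr 2 z := by
  refine .seq (.setNat (.seq (.storeNat (.seq (.setNat (.seq ?_))))))
  have hleaf := h.leafPos z z.isLt
  simp only [NatExpr.eval, Memory.setNat_natReg, Memory.setNat_natArr, Memory.storeNat_natReg,
    Memory.storeNat_natArr, hz, hleaf, Nat.add_sub_cancel, Nat.reduceEqDiff, if_false, if_true]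
  refine (RepresentsCore.sift_runs (x := z) (G := G) (P := P) (goal := goal) (b := b)
    (s := { s with queue := s.queue.erase z }) (RepresentsCore.congr (m := m)
      ⟨h.input, h.output, h.best, h.double, h.leafPos⟩ ?_ ?_ ?_ ?_) ?_ ?_ ?_).mono ?_
  · intro r hr
    simp [show r ≠ 2 by omega, show r ≠ 11 by omega]
  · intro _ _
    rfl
  · intro a ha
    simp [ha]
  · rfl
  · intro y
    by_cases hy : y = z
    · subst hy
      simp
    · have hyz : (y : ℕ) ≠ z := fun e => hy (Fin.ext e)
      simpa [hyz, hy] using h.queue y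
  · simp
  · simpa using h.tournament.update_leaf (fun i hi => h.leaf_eq hi) (i := z)
      (fun _ _ => rfl) 0
  · rintro m' ⟨h1, h2⟩
    have e2 : m'.natReg 2 = z := by simpa using h2.natReg 2 (by norm_num)
    exact .setNat ⟨h1.setNat (by norm_num), by simpa using e2, by simp [NatExpr.eval, e2]⟩

/-- The test whether the queue is nonempty. -/
def mainTest : Test := .neg (.natEq (.load 12 (.const 1)) (.const 0))

/-- One iteration of the main loop. -/
def mainBody : Program := .seq removeRoot (.while scanTest scanBody)

/-- The time for one iteration of the main loop, per predecessor. -/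
def mainTime (w : ℕ) : ℕ :=
  mainTest.time + scanTest.time + removeRoot.bound w + scanBody.bound w

lemma Represents.root_eq_zero_iff (h : Represents m G P goal s b) :
    m.natArr 12 1 = 0 ↔ s.queue = ∅ := by
  have hn : 0 < n := goal.pos
  constructor
  · intro h0
    rw [Finset.eq_empty_iff_forall_notMem]
    intro y hy
    refine (h.tournament.root_le (k := n + y) (by omega) (by omega) ?_).1 h0
    rw [h.queue y, if_pos hy]
    omega
  · intro h0
    obtain ⟨i, hi, hi'⟩ := h.tournament.exists_leaf (k := 1) le_rfl (by omega)
    rw [← hi', show n + i = n + ((⟨i, hi⟩ : Fin n) : ℕ) from rfl, h.queue, h0]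
    simp

/-- The tree compares stored reals, which are the true values only where these are finite; cells in
the queue have finite values. -/
lemma Represents.exists_root (h : Represents m G P goal s b) (hfin : ∀ y ∈ s.queue, s.g y ≠ ⊤)
    (h0 : m.natArr 12 1 ≠ 0) :
    ∃ z ∈ s.queue, m.natArr 12 1 = z + 1 ∧ ∀ y ∈ s.queue, s.g z ≤ s.g y := by
  have hn : 0 < n := goal.pos
  obtain ⟨i, hi, hi'⟩ := h.tournament.exists_leaf (k := 1) le_rfl (by omega)
  rw [← hi', show n + i = n + ((⟨i, hi⟩ : Fin n) : ℕ) from rfl, h.queue] at h0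
  have hz : (⟨i, hi⟩ : Fin n) ∈ s.queue := by
    by_contra hz
    simp [hz] at h0
  have hr : m.natArr 12 1 = i + 1 := by
    rw [← hi', show n + i = n + ((⟨i, hi⟩ : Fin n) : ℕ) from rfl, h.queue, if_pos hz]
  refine ⟨⟨i, hi⟩, hz, hr, fun y hy => ?_⟩
  have hy' : m.natArr 12 (n + y) = y + 1 := by rw [h.queue y, if_pos hy]
  have := (h.tournament.root_le (k := n + y) (by omega) (by omega) (by omega)).2
  rw [hr, hy', Nat.add_sub_cancel, Nat.add_sub_cancel, (h.output y).1.toReal (hfin y hy),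
    show m.realArr 2 i = _ from (h.output ⟨i, hi⟩).1.toReal (hfin _ hz)] at this
  exact (ENNReal.toReal_le_toReal (hfin _ hz) (hfin y hy)).1 this

/-- Each cell is removed at most once, so the cost is charged to the cells not yet removed: one unit
per predecessor entry and one for the removal. -/
lemma main_halts (hG : ∀ x, P.rate * P.cFlc ≤ G.cost x / G.length x) {k : ℕ}
    (h : Represents m G P goal s b) (hI : MainInv G P goal D s b) (hk : Dᶜ.card = k) :
    Halts (.while mainTest mainBody) m
      ((∑ x ∈ Dᶜ, ((G.pred x).card + 1)) * mainTime (siftTime n) + mainTest.time)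
      fun m' => ∃ s' b' D', Represents m' G P goal s' b' ∧ MainInv G P goal D' s' b' ∧
        s'.queue = ∅ := by
  induction k generalizing m s b D with
  | zero =>
    have hD : ∀ x, x ∈ D := by
      intro x
      by_contra hx
      rw [Finset.card_eq_zero] at hk
      have := Finset.mem_compl.2 hx
      simp [hk] at this
    have hq : s.queue = ∅ := Finset.eq_empty_iff_forall_notMem.2 fun x hx =>
      hI.router.notMem_queue x (hD x) hx
    refine .while_done ?_ ⟨s, b, D, h, hI, hq⟩ (by omega)
    simpa [mainTest, Test.Holds, NatExpr.eval, h.root_eq_zero_iff] using hq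
  | succ k ih =>
    by_cases hq : s.queue = ∅
    · refine .while_done ?_ ⟨s, b, D, h, hI, hq⟩ (by omega)
      simpa [mainTest, Test.Holds, NatExpr.eval, h.root_eq_zero_iff] using hq
    obtain ⟨z, hz, hr, hmin⟩ := h.exists_root
      (fun y hy => (hI.router.ne_top_iff y).2 (Or.inr hy)) (mt h.root_eq_zero_iff.1 hq)
    have hzD : z ∈ Dᶜ := Finset.mem_compl.2 fun hzD => hI.router.notMem_queue z hzD hz
    have hcompl : (insert z D)ᶜ = Dᶜ.erase z := by
      ext x
      simp
    refine .while_step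
      (T₁ := removeRoot.bound (siftTime n) + ((G.pred z).card *
        (scanTest.time + scanBody.bound (siftTime n)) + scanTest.time))
      (T₂ := (∑ x ∈ (insert z D)ᶜ, ((G.pred x).card + 1)) * mainTime (siftTime n) + mainTest.time)
      ?_ (.seq ?_) ?_
    · simpa [mainTest, Test.Holds, NatExpr.eval, h.root_eq_zero_iff] using hq
    · refine (removeRoot_runs h hr).mono ?_
      rintro m₁ ⟨h1, h2, h3⟩
      refine (scan_halts hG h1 (hI.remove hz hmin) h2 h3).mono le_rfl ?_
      rintro m₂ ⟨s₂, b₂, h4, h5⟩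
      refine ih h4 h5 ?_
      rw [hcompl, Finset.card_erase_of_mem hzD, hk, Nat.add_sub_cancel]
    · rw [hcompl, ← Finset.add_sum_erase _ _ hzD]
      simp only [mainTime]
      generalize ∑ x ∈ Dᶜ.erase z, ((G.pred x).card + 1) = S
      generalize (G.pred z).card = p
      generalize removeRoot.bound (siftTime n) = r
      generalize scanBody.bound (siftTime n) = t
      -- The charge `(p + 1) * mainTime` exceeds the actual cost of the iteration by this product
      -- plus `t`.
      nlinarith [Nat.zero_le (p * (mainTest.time + r))]

/-! ## Initialization -/

/-- The test whether there are further cells to initialize. -/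
def clearTest : Test := .natLt (.reg 2) (.reg 0)

/-- Initializing the entries of the cell `i` in the integer register `2`; the registers `3` and `4`
contain `2 * i` and `n + i`. -/
def clearBody : Program :=
  .seq (.storeNat 6 (.reg 2) (.const 0)) <|
  .seq (.storeNat 7 (.reg 2) (.const 0)) <|
  .seq (.storeNat 11 (.reg 2) (.const 0)) <|
  .seq (.storeNat 12 (.reg 2) (.const 0)) <|
  .seq (.storeNat 12 (.reg 4) (.const 0)) <|
  .seq (.storeNat 13 (.reg 2) (.reg 3)) <|
  .seq (.storeNat 14 (.reg 2) (.reg 4)) <|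
  .seq (.setNat 2 (.inc (.reg 2))) <|
  .seq (.setNat 3 (.inc (.inc (.reg 3)))) (.setNat 4 (.inc (.reg 4)))

/-- Setting the counters for the initialization. -/
def startClear : Program :=
  .seq (.setNat 2 (.const 0)) <| .seq (.setNat 3 (.const 0)) (.setNat 4 (.reg 0))

/-- The entries of the first `i` cells are initialized. -/
structure Cleared (m : Memory) (G : LaneGraph (Fin n)) (P : Params) (goal : Fin n) (i : ℕ) :
    Prop where
  input : StoresInput m G P goal
  counter : m.natReg 2 = i
  counterDouble : m.natReg 3 = 2 * i
  counterLeaf : m.natReg 4 = n + i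
  zero : ∀ a, a = 6 ∨ a = 7 ∨ a = 11 ∨ a = 12 → ∀ j < i, m.natArr a j = 0
  leaf : ∀ j < i, m.natArr 12 (n + j) = 0
  double : ∀ j < i, m.natArr 13 j = 2 * j
  leafPos : ∀ j < i, m.natArr 14 j = n + j

lemma clearBody_runs {i w : ℕ} (h : Cleared m G P goal i) :
    Runs w clearBody m fun m' => Cleared m' G P goal (i + 1) := by
  refine .seq (.storeNat (.seq (.storeNat (.seq (.storeNat (.seq (.storeNat (.seq (.storeNat
    (.seq (.storeNat (.seq (.storeNat (.seq (.setNat (.seq (.setNat (.setNat ?_))))))))))))))))))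
  simp only [NatExpr.eval, Memory.setNat_natReg, Memory.storeNat_natReg, h.counter,
    h.counterDouble, h.counterLeaf, Nat.reduceEqDiff, if_false]
  refine ⟨h.input.congr (fun r hr => ?_) (fun _ _ => rfl) (fun a ha => ?_) (fun _ _ => rfl),
    by simp, by simp; ring, by simp; ring, ?_, ?_, ?_, ?_⟩
  · simp [show r ≠ 2 by omega, show r ≠ 3 by omega, show r ≠ 4 by omega]
  · simp [show a ≠ 6 by omega, show a ≠ 7 by omega, show a ≠ 11 by omega, show a ≠ 12 by omega,
      show a ≠ 13 by omega, show a ≠ 14 by omega]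
  · intro a ha j hj
    have := h.zero a ha j
    rcases ha with rfl | rfl | rfl | rfl <;>
      simp only [Memory.setNat_natArr, Memory.storeNat_natArr, Function.update_apply,
        Nat.reduceEqDiff, if_true, if_false] <;> grind
  · intro j hj
    have := h.leaf j
    simp only [Memory.setNat_natArr, Memory.storeNat_natArr, Function.update_apply,
      Nat.reduceEqDiff, if_true, if_false]
    grind
  · intro j hj
    have := h.double j
    simp only [Memory.setNat_natArr, Memory.storeNat_natArr, Function.update_apply,
      Nat.reduceEqDiff, if_true, if_false]
    grind
  · intro j hj
    have := h.leafPos j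
    simp only [Memory.setNat_natArr, Memory.storeNat_natArr, Function.update_apply,
      Nat.reduceEqDiff, if_true, if_false]
    grind

/-- An all-empty tree is a tournament whatever the uninitialized reals are. The goal is absent here;
entering it then yields `routerInit`. -/
lemma Cleared.represents (h : Cleared m G P goal n) :
    Represents m G P goal ⟨fun _ => ⊤, fun _ => none, ∅⟩ fun _ => none := by
  have hT : ∀ j < 2 * n, m.natArr 12 j = 0 := by
    intro j hj
    by_cases hjn : j < n
    · exact h.zero 12 (by simp) j hjn
    · obtain ⟨i, rfl⟩ := Nat.exists_eq_add_of_le (not_lt.1 hjn)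
      exact h.leaf i (by omega)
  refine ⟨⟨h.input, fun x => ⟨Or.inl ⟨h.zero 6 (by simp) x x.isLt, rfl⟩,
    h.zero 7 (by simp) x x.isLt⟩, fun x => h.zero 11 (by simp) x x.isLt, h.double, h.leafPos⟩,
    fun x => ?_, fun j h1 h2 => ?_⟩
  · simpa using hT (n + x) (by omega)
  · rw [hT j (by omega), hT (2 * j) (by omega), hT (2 * j + 1) (by omega)]
    rfl

/-- Entering the goal with value `0`. -/
def enterGoal : Program :=
  .seq (.setNat 6 (.reg 1)) <| .seq (.setReal 3 (.const 0)) enter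

lemma enterGoal_runs (h : Represents m G P goal ⟨fun _ => ⊤, fun _ => none, ∅⟩ fun _ => none) :
    Runs (siftTime n) enterGoal m fun m' =>
      Represents m' G P goal (routerInit goal) fun _ => none := by
  refine .seq (.setNat (.seq (.setReal ?_)))
  refine (enter_runs (x := goal) ((h.setNat (r := 6) (by norm_num)).setReal (r := 3)
    (by norm_num)) ?_ ?_).mono ?_
  · simp [NatExpr.eval, h.input.goal]
  · simp [RealExpr.eval]
  · rintro m' ⟨h1, -⟩
    simpa [RealExpr.eval, routerInit] using h1

/-- The program that computes a solution. -/
def routerProgram : Program :=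
  .seq startClear <| .seq (.while clearTest clearBody) <|
    .seq enterGoal (.while mainTest mainBody)

/-- The running time of the program on an instance with `n` cells and `e` predecessors. -/
def routerTime (n e : ℕ) : ℕ :=
  startClear.bound 1 + (n * (clearTest.time + clearBody.bound 1) + clearTest.time +
    (enterGoal.bound (siftTime n) + ((e + n) * mainTime (siftTime n) + mainTest.time)))

lemma routerProgram_halts (hG : ∀ x, P.rate * P.cFlc ≤ G.cost x / G.length x)
    (h : StoresInput m G P goal) :
    Halts routerProgram m (routerTime n (∑ x, (G.pred x).card)) fun m' =>
      ∃ g π, StoresOutput m' g π ∧ IsSolution G P goal g π := by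
  refine .seq ?_
  have hstart : Runs 1 startClear m fun m' => Cleared m' G P goal 0 := by
    refine .seq (.setNat (.seq (.setNat (.setNat ?_))))
    refine ⟨h.congr (fun r hr => ?_) (fun _ _ => rfl) (fun _ _ => rfl) (fun _ _ => rfl),
      by simp [NatExpr.eval], by simp [NatExpr.eval], by simp [NatExpr.eval, h.size], by simp,
      by simp, by simp, by simp⟩
    simp [show r ≠ 2 by omega, show r ≠ 3 by omega, show r ≠ 4 by omega]
  refine hstart.mono fun m₁ h1 => .seq ?_
  refine (Halts.while_count (T := clearBody.bound 1) (k := n)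
    (I := fun k m' => ∃ i, i + k = n ∧ Cleared m' G P goal i) ?_ ?_ ⟨0, by simp, h1⟩).mono le_rfl ?_
  · rintro m' ⟨i, hi, h2⟩
    simp only [clearTest, Test.Holds, NatExpr.eval, h2.counter, h2.input.size]
    omega
  · rintro k m' ⟨i, hi, h2⟩
    refine ⟨?_, (clearBody_runs (w := 1) h2).mono fun m'' h3 => ⟨i + 1, by omega, h3⟩⟩
    simp only [clearTest, Test.Holds, NatExpr.eval, h2.counter, h2.input.size]
    omega
  rintro m₂ ⟨i, hi, h2⟩
  obtain rfl : i = n := by omega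
  refine .seq ((enterGoal_runs h2.represents).mono fun m₃ h3 => ?_)
  refine (main_halts hG h3 .init rfl).mono ?_ ?_
  · simp [Finset.sum_add_distrib]
  · rintro m₄ ⟨s', b', D', h4, h5, h6⟩
    exact ⟨s'.g, s'.act, h4.output, h5.router.isSolution hG h6⟩

end MainLoop

/-! ## The running time -/

lemma siftTime_pos (n : ℕ) : 1 ≤ siftTime n := by
  have : 1 ≤ siftTest.time := by simp [siftTest, Test.time]
  exact this.trans (Nat.le_add_left _ _)

lemma siftTime_le (n : ℕ) :
    siftTime n ≤ (Nat.log 2 n + 1) * (2 * siftTest.time + siftBody.bound 0) := by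
  unfold siftTime
  nlinarith [Nat.zero_le (Nat.log 2 n * siftTest.time)]

/-- Every summand of the running time is at most a constant of the code times `(K + 1) * n *
siftTime n`, and `siftTime_le` turns the last factor into a logarithm. -/
lemma exists_routerTime_le : ∃ A : ℕ, ∀ n e K : ℕ, 1 ≤ n → e ≤ K * n →
    routerTime n e ≤ A * ((K + 1) * n * (Nat.log 2 n + 1)) := by
  refine ⟨(startClear.bound 1 + (clearTest.time + clearBody.bound 1) + clearTest.time +
    enterGoal.bound 1 + (mainTest.time + scanTest.time + removeRoot.bound 1 + scanBody.bound 1) +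
    mainTest.time) * (2 * siftTest.time + siftBody.bound 0), fun n e K hn he => ?_⟩
  have hw := siftTime_pos n
  have hK : n ≤ (K + 1) * n := Nat.le_mul_of_pos_left n (by omega)
  have hX1 : 1 ≤ (K + 1) * n * siftTime n := Nat.one_le_iff_ne_zero.2 (by positivity)
  have hXn : n ≤ (K + 1) * n * siftTime n := hK.trans (Nat.le_mul_of_pos_right _ hw)
  have hXw : siftTime n ≤ (K + 1) * n * siftTime n := Nat.le_mul_of_pos_left _ (by positivity)
  have h1 : enterGoal.bound (siftTime n) ≤ enterGoal.bound 1 * ((K + 1) * n * siftTime n) :=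
    (Program.bound_le_mul hw _).trans (by gcongr)
  have h2 : mainTime (siftTime n) ≤ (mainTest.time + scanTest.time + removeRoot.bound 1 +
      scanBody.bound 1) * siftTime n := by
    have i1 := Program.bound_le_mul hw removeRoot
    have i2 := Program.bound_le_mul hw scanBody
    unfold mainTime
    nlinarith [Nat.le_mul_of_pos_right (mainTest.time + scanTest.time) hw]
  have h3 : (e + n) * mainTime (siftTime n) ≤ (mainTest.time + scanTest.time +
      removeRoot.bound 1 + scanBody.bound 1) * ((K + 1) * n * siftTime n) := by
    calc (e + n) * mainTime (siftTime n)
        ≤ ((K + 1) * n) * ((mainTest.time + scanTest.time + removeRoot.bound 1 +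
          scanBody.bound 1) * siftTime n) := by
          gcongr
          linarith
      _ = _ := by ring
  have h4 : (K + 1) * n * siftTime n ≤
      (2 * siftTest.time + siftBody.bound 0) * ((K + 1) * n * (Nat.log 2 n + 1)) := by
    calc (K + 1) * n * siftTime n
        ≤ (K + 1) * n * ((Nat.log 2 n + 1) * (2 * siftTest.time + siftBody.bound 0)) := by
          gcongr
          exact siftTime_le n
      _ = _ := by ring
  rw [mul_assoc]
  refine le_trans ?_ (Nat.mul_le_mul_left _ h4)
  have h5 := Nat.mul_le_mul_right (clearTest.time + clearBody.bound 1) hXn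
  have h6 := Nat.le_mul_of_pos_right (startClear.bound 1) hX1
  have h7 := Nat.le_mul_of_pos_right clearTest.time hX1
  have h8 := Nat.le_mul_of_pos_right mainTest.time hX1
  unfold routerTime
  simp only [add_mul] at *
  linarith

/-- For `n ≥ 1`, both `log₂ n` and `1` are at most `log₂ (n + 1)`, whence the factor 2. -/
lemma log_add_one_le {n : ℕ} (hn : 1 ≤ n) :
    ((Nat.log 2 n : ℕ) : ℝ) + 1 ≤ 2 / Real.log 2 * Real.log (n + 1) := by
  have hn' : (1 : ℝ) ≤ n := by exact_mod_cast hn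
  have h2 : 0 < Real.log 2 := Real.log_pos (by norm_num)
  have h3 : Real.log n ≤ Real.log (n + 1) := Real.log_le_log (by linarith) (by linarith)
  have h4 : Real.log 2 ≤ Real.log (n + 1) := Real.log_le_log (by norm_num) (by linarith)
  have h5 : ((Nat.log 2 n : ℕ) : ℝ) ≤ Real.log n / Real.log 2 := by
    have := Real.natLog_le_logb n 2
    simpa [Real.logb] using this
  rw [le_div_iff₀ h2] at h5
  rw [div_mul_eq_mul_div, le_div_iff₀ h2]
  linarith

lemma sum_card_pred_le {n : ℕ} (G : LaneGraph (Fin n)) :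
    ∑ x, (G.pred x).card ≤ G.edgeCount :=
  Finset.sum_le_sum fun _ _ => Nat.le_add_left _ _

end LaneRouting

end

/-! ### Correctness and running time combined -/

theorem mainTheorem2 :
    -- the Dijkstra-like algorithm stops after at most `n` iterations with the optimal solution
    (∀ (X : Type*) [Fintype X] [DecidableEq X] (G : LaneRouting.LaneGraph X)
        (P : LaneRouting.Params) (goal : X),
      (∀ x, P.rate * P.cFlc ≤ G.cost x / G.length x) →
        (∃ k s, LaneRouting.RouterRun G P goal k s ∧ s.queue = ∅) ∧
        ∀ k s, LaneRouting.RouterRun G P goal k s →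
          k ≤ Fintype.card X ∧
          (s.queue = ∅ → LaneRouting.IsSolution G P goal s.g s.act)) ∧
    -- a program computes the optimal solution in time `O(n log n)`
    (∃ prog : LaneRouting.Program, ∀ K : ℕ, ∃ C : ℝ,
      ∀ (n : ℕ) (G : LaneRouting.LaneGraph (Fin n)) (P : LaneRouting.Params) (goal : Fin n)
        (m : LaneRouting.Memory),
      (∀ x, P.rate * P.cFlc ≤ G.cost x / G.length x) →
      G.edgeCount ≤ K * n →
      LaneRouting.StoresInput m G P goal →
        ∃ (t : ℕ) (m' : LaneRouting.Memory),
          LaneRouting.Exec prog m t m' ∧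
          (t : ℝ) ≤ C * (n * Real.log (n + 1)) ∧
          ∃ (g : Fin n → ℝ≥0∞) (π : Fin n → Option (LaneRouting.Action (Fin n))),
            LaneRouting.StoresOutput m' g π ∧ LaneRouting.IsSolution G P goal g π) := by

  refine ⟨fun X _ _ G P goal hG => ⟨LaneRouting.RouterRun.exists_halting hG, fun k s hs =>
    ⟨hs.le_card hG, hs.isSolution hG⟩⟩, LaneRouting.routerProgram, fun K => ?_⟩
  obtain ⟨A, hA⟩ := LaneRouting.exists_routerTime_le
  refine ⟨A * (K + 1) * (2 / Real.log 2), fun n G P goal m hG hE hm => ?_⟩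
  obtain ⟨t, m', h1, h2, h3⟩ := LaneRouting.routerProgram_halts hG hm
  refine ⟨t, m', h1, ?_, h3⟩
  -- The goal cell excludes `n = 0`, as the logarithmic bounds require.
  have hn : 1 ≤ n := goal.pos
  have ht := h2.trans (hA n _ K hn ((LaneRouting.sum_card_pred_le G).trans hE))
  calc (t : ℝ) ≤ A * ((K + 1) * n * ((Nat.log 2 n : ℕ) + 1)) := by exact_mod_cast ht
    _ ≤ A * ((K + 1) * n * (2 / Real.log 2 * Real.log (n + 1))) := by
      gcongr
      exact LaneRouting.log_add_one_le hn
    _ = _ := by ring
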